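/- **Theorem 3.1.** Let $\mathrm{Pr},\mathrm{Le},L_1,L_2>0$ with $\mathrm{Le}\neq 1$, let $R,\tilde R\in\mathbb R$, let $\Omega=(0,L_1)\times(0,L_2)\times(0,1)$, and consider the eigenvalue problem $$\mathrm{Pr}(\Delta u-\nabla p)+\mathrm{Pr}\,\bigl(RT-\operatorname{sign}(\tilde R)\tilde R S\bigr)\vec k=\beta u,\quad \Delta T+u_3=\beta T,\quad \mathrm{Le}\,\Delta S+\operatorname{sign}(\tilde R)u_3=\beta S,\quad \operatorname{div}u=0$$ for $0\ne(u,T,S)\in H^2(\Omega;\mathbb C)^5$, $p\in H^1(\Omega;\mathbb C)$, $\vec k=(0,0,1)$, with the boundary conditions: $u_1=0$, $\partial_1u_2=\partial_1u_3=\partial_1T=\partial_1S=0$ at $x_1=0,L_1$; $u_2=0$, $\partial_2u_1=\partial_2u_3=\partial_2T=\partial_2S=0$ at $x_2=0,L_2$; $u_3=T=S=0$, $\partial_3u_1=\partial_3u_2=0$ at $x_3=0,1$. For integers $j,k,l\ge 0$ put $\alpha_{jk}^2=\pi^2(j^2L_1^{-2}+k^2L_2^{-2})$ and $\gamma_{jkl}^2=\alpha_{jk}^2+l^2\pi^2$.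 The *eigenvalues of the mode* $(j,k,l)$ are: $-\mathrm{Pr}\,\alpha_{jk}^2$ if $l=0$ and $(j,k)\ne(0,0)$; $-l^2\pi^2$ and $-\mathrm{Le}\,l^2\pi^2$ if $j=k=0$ and $l\neq0$; and, if $(j,k)\neq(0,0)$ and $l\ne0$, the three zeros $\beta^1_{jkl},\beta^2_{jkl},\beta^3_{jkl}$ (with multiplicity, $\operatorname{Re}\beta^1_{jkl}\ge\operatorname{Re}\beta^2_{jkl}\ge\operatorname{Re}\beta^3_{jkl}$) of $$\gamma_{jkl}^2(\gamma_{jkl}^2+\beta)(\mathrm{Le}\,\gamma_{jkl}^2+\beta)(\mathrm{Pr}\,\gamma_{jkl}^2+\beta)-\mathrm{Pr}\,R\,\alpha_{jk}^2(\mathrm{Le}\,\gamma_{jkl}^2+\beta)+\mathrm{Pr}\,\tilde R\,\alpha_{jk}^2(\gamma_{jkl}^2+\beta)=0 .$$ Let $$\sigma=R-\mathrm{Le}^{-1}\tilde R,\qquad \eta=R-\frac{\mathrm{Pr}+\mathrm{Le}}{\mathrm{Pr}+1}\tilde R,\qquad \sigma_c=\min_{j,k\ge0,\ (j,k)\neq(0,0)}\frac{\pi^4(j^2L_1^{-2}+k^2L_2^{-2}+1)^3}{j^2L_1^{-2}+k^2L_2^{-2}},$$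 $$\eta_c=\frac{(\mathrm{Pr}+\mathrm{Le})(1+\mathrm{Le})}{\mathrm{Pr}}\sigma_c,\qquad K=\operatorname{sign}(1-\mathrm{Le})\left[\frac{\mathrm{Le}^2}{1-\mathrm{Le}}\Bigl(1+\frac1{\mathrm{Pr}}\Bigr)\sigma_c-\tilde R\right].$$ Call $(j,k)$ *critical* if it attains the minimum $\sigma_c$, and let $(j_1,k_1)$ be critical. Fix $\tilde R$ and let $R$ (hence $\sigma$ and $\eta$) vary over $\mathbb R$. We call $\sigma_c$ (resp. $\eta_c$) the first critical Rayleigh number if $\operatorname{Re}\beta\le0$ for every eigenvalue $\beta$ of the problem at $\sigma=\sigma_c$ (resp. $\eta=\eta_c$). 1. If $K>0$, then $\sigma_c$ is the first critical Rayleigh number. The number $\beta^1_{j_1k_11}$ is an eigenvalue of the problem for every $R$; $\operatorname{Re}\beta^1_{j_1k_11}<0$ if $\sigma<\sigma_c$; $\beta^1_{j_1k_11}=0$ if $\sigma=\sigma_c$; $\beta^1_{j_1k_11}$ is real and positive if $\sigma>\sigma_c$; and there is $\varepsilon>0$ such that $\beta^1_{j_1k_11}$ is real whenever $|\sigma-\sigma_c|<\varepsilon$.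 At $\sigma=\sigma_c$: $\operatorname{Re}\beta^2_{j_1k_11}<0$ and $\operatorname{Re}\beta^3_{j_1k_11}<0$; all eigenvalues of every mode $(j,k,l)$ other than those with $l=1$ and $(j,k)$ critical have negative real part; and every eigenvalue $\beta\neq0$ of the problem has $\operatorname{Re}\beta<0$. 2. If $K<0$, then $\eta_c$ is the first critical Rayleigh number. The numbers $\beta^1_{j_1k_11},\beta^2_{j_1k_11}$ are eigenvalues of the problem for every $R$. Both have negative real part if $\eta<\eta_c$ and zero real part if $\eta=\eta_c$, and $\operatorname{Re}\beta^1_{j_1k_11}>0$ if $\eta>\eta_c$. There is $\varepsilon>0$ such that, whenever $|\eta-\eta_c|<\varepsilon$, $\beta^1_{j_1k_11}$ and $\beta^2_{j_1k_11}$ are nonreal complex conjugates of each other, so $\operatorname{Re}\beta^1_{j_1k_11}=\operatorname{Re}\beta^2_{j_1k_11}$, and both real parts are positive if in addition $\eta>\eta_c$. At $\eta=\eta_c$: $\operatorname{Re}\beta^3_{j_1k_11}<0$; all eigenvalues of every mode $(j,k,l)$ other than those with $l=1$ and $(j,k)$ critical have negative real part; and every eigenvalue $\beta$ of the problem that is not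 one of $\beta^1_{jk1},\beta^2_{jk1}$ for a critical $(j,k)$ has $\operatorname{Re}\beta<0$. -/

import Mathlib

open MeasureTheory
open scoped ContDiff

noncomputable section

namespace Thermohaline

/-! ## Sobolev functions on the box `(0, L₁) × (0, L₂) × (0, 1)` -/

/-- The side lengths of the nondimensional domain. -/
def side (L₁ L₂ : ℝ) : Fin 3 → ℝ := ![L₁, L₂, 1]

/-- The nondimensional domain `Ω = (0, L₁) × (0, L₂) × (0, 1)`. -/
def box (L₁ L₂ : ℝ) : Set (Fin 3 → ℝ) := {x | ∀ i, 0 < x i ∧ x i < side L₁ L₂ i}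

/-- The classical partial derivative `∂φ/∂xᵢ` of a (smooth, real) test function. -/
def pderiv (i : Fin 3) (φ : (Fin 3 → ℝ) → ℝ) (x : Fin 3 → ℝ) : ℝ :=
  fderiv ℝ φ x (Pi.single i 1)

/-- `g` is the weak partial derivative `∂f/∂xᵢ` in the open set `Ω`
(tested against `C_c^∞(Ω)`). -/
def HasWeakPartial (Ω : Set (Fin 3 → ℝ)) (i : Fin 3) (f g : (Fin 3 → ℝ) → ℂ) : Prop :=
  ∀ φ : (Fin 3 → ℝ) → ℝ, ContDiff ℝ ∞ φ → HasCompactSupport φ → tsupport φ ⊆ Ω →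
    ∫ x in Ω, f x * (pderiv i φ x : ℂ) = -∫ x in Ω, g x * (φ x : ℂ)

/-- The trace of `f` vanishes on the two faces of the box orthogonal to the `xᵢ`-axis, where
`g = ∂f/∂xᵢ`. Integration by parts in the variable `xᵢ` produces boundary terms on these two faces
only, so the trace vanishes there if and only if there is no boundary term for any test function
that is smooth up to the boundary (and not required to vanish anywhere). -/
def VanishesOnFaces (Ω : Set (Fin 3 → ℝ)) (i : Fin 3) (f g : (Fin 3 → ℝ) → ℂ) : Prop :=
  ∀ φ : (Fin 3 → ℝ) → ℝ, ContDiff ℝ ∞ φ →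
    ∫ x in Ω, f x * (pderiv i φ x : ℂ) = -∫ x in Ω, g x * (φ x : ℂ)

/-- A complex function in `H¹(Ω)` together with its weak gradient. -/
structure SobolevH1 (Ω : Set (Fin 3 → ℝ)) where
  val : (Fin 3 → ℝ) → ℂ
  grad : Fin 3 → (Fin 3 → ℝ) → ℂ
  memLp_val : MemLp val 2 (volume.restrict Ω)
  memLp_grad : ∀ i, MemLp (grad i) 2 (volume.restrict Ω)
  weak_grad : ∀ i, HasWeakPartial Ω i val (grad i)

/-- A complex function in `H²(Ω)` together with its first and second weak derivatives;
`hess i j` is `∂²f/∂xⱼ∂xᵢ`. -/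
structure SobolevH2 (Ω : Set (Fin 3 → ℝ)) extends SobolevH1 Ω where
  hess : Fin 3 → Fin 3 → (Fin 3 → ℝ) → ℂ
  memLp_hess : ∀ i j, MemLp (hess i j) 2 (volume.restrict Ω)
  weak_hess : ∀ i j, HasWeakPartial Ω j (grad i) (hess i j)

/-- The Laplacian of an `H²` function. -/
def SobolevH2.lap {Ω : Set (Fin 3 → ℝ)} (f : SobolevH2 Ω) (x : Fin 3 → ℝ) : ℂ :=
  ∑ i, f.hess i i x

/-- `f = 0` on the two faces orthogonal to the `xᵢ`-axis. -/
def SobolevH2.Dirichlet {Ω : Set (Fin 3 → ℝ)} (f : SobolevH2 Ω) (i : Fin 3) : Prop :=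
  VanishesOnFaces Ω i f.val (f.grad i)

/-- `∂f/∂xᵢ = 0` on the two faces orthogonal to the `xᵢ`-axis. -/
def SobolevH2.Neumann {Ω : Set (Fin 3 → ℝ)} (f : SobolevH2 Ω) (i : Fin 3) : Prop :=
  VanishesOnFaces Ω i (f.grad i) (f.hess i i)

/-! ## The linearized eigenvalue problem -/

/-- The free boundary conditions for `ψ = (u, T, S)`: on the faces orthogonal to the `xᵢ`-axis,
`uᵢ = 0` and `∂u_m/∂xᵢ = 0` for `m ≠ i`; for `T` and `S`, the normal derivative vanishes on the
lateral faces, and `T = S = 0` at `x₃ = 0, 1`. -/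
structure FreeBoundary {Ω : Set (Fin 3 → ℝ)} (u : Fin 3 → SobolevH2 Ω) (T S : SobolevH2 Ω) :
    Prop where
  u_normal : ∀ i, (u i).Dirichlet i
  u_tangential : ∀ i m, m ≠ i → (u m).Neumann i
  T_lateral : T.Neumann 0 ∧ T.Neumann 1
  S_lateral : S.Neumann 0 ∧ S.Neumann 1
  T_vertical : T.Dirichlet 2
  S_vertical : S.Dirichlet 2

/-- The linearized Boussinesq equations
`Pr (Δu - ∇p) + Pr (R T - sign(S₀ - S₁) R̃ S) k = β u`, `ΔT + u₃ = β T`,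
`Le ΔS + sign(S₀ - S₁) u₃ = β S`, `div u = 0`, almost everywhere in `Ω`.
The saline Rayleigh number `R̃` (here `Rt`) is a positive multiple of `S₀ - S₁`, so
`sign(S₀ - S₁)` is the sign of `R̃`. -/
structure SolvesEigenEquations {Ω : Set (Fin 3 → ℝ)} (Pr Le R Rt : ℝ) (β : ℂ)
    (u : Fin 3 → SobolevH2 Ω) (T S : SobolevH2 Ω) (p : SobolevH1 Ω) : Prop where
  momentum : ∀ i, ∀ᵐ x ∂(volume.restrict Ω),
    (Pr : ℂ) * ((u i).lap x - p.grad i x)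
      + (if i = 2 then
          (Pr : ℂ) * ((R : ℂ) * T.val x - (Real.sign Rt : ℂ) * (Rt : ℂ) * S.val x) else 0)
      = β * (u i).val x
  heat : ∀ᵐ x ∂(volume.restrict Ω), T.lap x + (u 2).val x = β * T.val x
  salt : ∀ᵐ x ∂(volume.restrict Ω),
    (Le : ℂ) * S.lap x + (Real.sign Rt : ℂ) * (u 2).val x = β * S.val x
  div_free : ∀ᵐ x ∂(volume.restrict Ω), ∑ i, (u i).grad i x = 0

/-- `β` is an eigenvalue of the linearized problem with free boundary conditions: there are
`(u, T, S) ≠ 0` in `H²(Ω)⁵` and a pressure `p` in `H¹(Ω)` solving it. -/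
def IsEigenvalue (Pr Le L₁ L₂ R Rt : ℝ) (β : ℂ) : Prop :=
  ∃ (u : Fin 3 → SobolevH2 (box L₁ L₂)) (T S : SobolevH2 (box L₁ L₂))
    (p : SobolevH1 (box L₁ L₂)),
    (¬ ∀ᵐ x ∂(volume.restrict (box L₁ L₂)),
      (∀ i, (u i).val x = 0) ∧ T.val x = 0 ∧ S.val x = 0) ∧
    FreeBoundary u T S ∧ SolvesEigenEquations Pr Le R Rt β u T S p

/-! ## Modes and their eigenvalues -/

/-- `α²_{jk} = π² (j² L₁⁻² + k² L₂⁻²)`. -/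
def alphaSq (L₁ L₂ : ℝ) (j k : ℕ) : ℝ :=
  Real.pi ^ 2 * ((j : ℝ) ^ 2 * (L₁ ^ 2)⁻¹ + (k : ℝ) ^ 2 * (L₂ ^ 2)⁻¹)

/-- `γ²_{jkl} = α²_{jk} + l² π²`. -/
def gammaSq (L₁ L₂ : ℝ) (j k l : ℕ) : ℝ :=
  alphaSq L₁ L₂ j k + (l : ℝ) ^ 2 * Real.pi ^ 2

/-- The left-hand side of the cubic equation for the eigenvalues of the mode `(j, k, l)`. -/
def cubic (Pr Le L₁ L₂ R Rt : ℝ) (j k l : ℕ) (β : ℂ) : ℂ :=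
  let α2 : ℂ := (alphaSq L₁ L₂ j k : ℂ)
  let γ2 : ℂ := (gammaSq L₁ L₂ j k l : ℂ)
  γ2 * (γ2 + β) * (Le * γ2 + β) * (Pr * γ2 + β)
    - Pr * R * α2 * (Le * γ2 + β) + Pr * Rt * α2 * (γ2 + β)

/-- `b 0, b 1, b 2` are the three zeros `β¹, β², β³` (with multiplicity) of the cubic of the mode
`(j, k, l)`, numbered so that `Re β¹ ≥ Re β² ≥ Re β³`. The leading coefficient is `γ²_{jkl}`. -/
structure IsOrderedZeros (Pr Le L₁ L₂ R Rt : ℝ) (j k l : ℕ) (b : Fin 3 → ℂ) : Prop where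
  factor : ∀ z : ℂ, cubic Pr Le L₁ L₂ R Rt j k l z
    = (gammaSq L₁ L₂ j k l : ℂ) * ((z - b 0) * (z - b 1) * (z - b 2))
  order₁ : (b 1).re ≤ (b 0).re
  order₂ : (b 2).re ≤ (b 1).re

/-- `β` is one of the eigenvalues listed for the mode `(j, k, l)`: `-Pr α²_{jk}` if `l = 0`
(and `(j, k) ≠ (0, 0)`); `-l² π²` and `-Le l² π²` if `j = k = 0` and `l ≠ 0`; the three zeros of
the cubic if `(j, k) ≠ (0, 0)` and `l ≠ 0`. -/
def IsModeEigenvalue (Pr Le L₁ L₂ R Rt : ℝ) (j k l : ℕ) (β : ℂ) : Prop :=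
  ((j ≠ 0 ∨ k ≠ 0) ∧ l = 0 ∧ β = ((-(Pr * alphaSq L₁ L₂ j k) : ℝ) : ℂ)) ∨
  (j = 0 ∧ k = 0 ∧ l ≠ 0 ∧
    (β = ((-((l : ℝ) ^ 2 * Real.pi ^ 2) : ℝ) : ℂ) ∨
      β = ((-(Le * (l : ℝ) ^ 2 * Real.pi ^ 2) : ℝ) : ℂ))) ∨
  ((j ≠ 0 ∨ k ≠ 0) ∧ l ≠ 0 ∧ cubic Pr Le L₁ L₂ R Rt j k l β = 0)

/-! ## Rayleigh numbers and their critical values -/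

/-- The R-Rayleigh number `σ = R - Le⁻¹ R̃`. -/
def rRayleigh (Le R Rt : ℝ) : ℝ := R - Le⁻¹ * Rt

/-- The C-Rayleigh number `η = R - (Pr + Le) / (Pr + 1) R̃`. -/
def cRayleigh (Pr Le R Rt : ℝ) : ℝ := R - (Pr + Le) / (Pr + 1) * Rt

/-- `π⁴ (j² L₁⁻² + k² L₂⁻² + 1)³ / (j² L₁⁻² + k² L₂⁻²)`, for `(j, k) ≠ (0, 0)`. -/
def modeRayleigh (L₁ L₂ : ℝ) (j k : ℕ) : ℝ :=
  Real.pi ^ 4 * ((j : ℝ) ^ 2 * (L₁ ^ 2)⁻¹ + (k : ℝ) ^ 2 * (L₂ ^ 2)⁻¹ + 1) ^ 3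
    / ((j : ℝ) ^ 2 * (L₁ ^ 2)⁻¹ + (k : ℝ) ^ 2 * (L₂ ^ 2)⁻¹)

/-- The critical R-Rayleigh number `σ_c`: the minimum of `modeRayleigh` over all
`(j, k) ≠ (0, 0)` with `j, k ≥ 0`. -/
def sigmaC (L₁ L₂ : ℝ) : ℝ :=
  sInf {s | ∃ j k : ℕ, (j ≠ 0 ∨ k ≠ 0) ∧ s = modeRayleigh L₁ L₂ j k}

/-- `(j, k)` attains the minimum that defines `σ_c`. -/
def IsCriticalMode (L₁ L₂ : ℝ) (j k : ℕ) : Prop :=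
  (j ≠ 0 ∨ k ≠ 0) ∧ modeRayleigh L₁ L₂ j k = sigmaC L₁ L₂

/-- The critical C-Rayleigh number `η_c`. -/
def etaC (Pr Le L₁ L₂ : ℝ) : ℝ := (Pr + Le) * (1 + Le) / Pr * sigmaC L₁ L₂

/-- The parameter `K = sign(1 - Le) [Le² / (1 - Le) (1 + 1/Pr) σ_c - R̃]`. -/
def K (Pr Le L₁ L₂ Rt : ℝ) : ℝ :=
  Real.sign (1 - Le) * (Le ^ 2 / (1 - Le) * (1 + 1 / Pr) * sigmaC L₁ L₂ - Rt)

/-- `σ_c` is the first critical Rayleigh number: at `σ = σ_c` all eigenvalues of the linearized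
problem satisfy `Re β ≤ 0`. The saline Rayleigh number is fixed and `R` varies with `σ`. -/
def SigmaCIsFirstCritical (Pr Le L₁ L₂ Rt : ℝ) : Prop :=
  ∀ R : ℝ, rRayleigh Le R Rt = sigmaC L₁ L₂ →
    ∀ β : ℂ, IsEigenvalue Pr Le L₁ L₂ R Rt β → β.re ≤ 0

/-- `η_c` is the first critical Rayleigh number: at `η = η_c` all eigenvalues of the linearized
problem satisfy `Re β ≤ 0`. The saline Rayleigh number is fixed and `R` varies with `η`. -/
def EtaCIsFirstCritical (Pr Le L₁ L₂ Rt : ℝ) : Prop :=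
  ∀ R : ℝ, cRayleigh Pr Le R Rt = etaC Pr Le L₁ L₂ →
    ∀ β : ℂ, IsEigenvalue Pr Le L₁ L₂ R Rt β → β.re ≤ 0

end Thermohaline

end

open Thermohaline

/-!
The modes are products of sines and cosines. Those of the type prescribed by the boundary conditions
diagonalize the Laplacian, so that the Fourier coefficients of an eigenfunction solve, for each
triple `(j, k, l)`, a finite linear system (`coeff_equations`). After elimination of the pressure
this system has a nonzero solution only if `β` is a zero of the cubic of the mode or a negative real
number; the latter covers the listed eigenvalues with `l = 0` or `j = k = 0` and also `-Pr γ²`, which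
belongs to horizontal flows (`exists_cubic_eq_zero_of_isEigenvalue`). Conversely, a zero of the cubic
of `(j, k, 1)` gives an explicit eigenfunction (`isEigenvalue_of_cubic`). Two analytic facts are
needed. First, a weak derivative in the direction `i` may be tested against a mode that is a sine in
that direction (`HasWeakPartial.integral_mode`): cutoff functions have derivatives of the order of
the reciprocal of the distance to the boundary, where the sine vanishes. Second, the modes of one
type are complete (`ae_eq_zero_of_integral_mode_eq_zero`): their span is stable under multiplication
by `cos (π xᵢ / Lᵢ)`, and these functions generate a dense algebra by Stone–Weierstrass.

The rest concerns the cubic `β³ + c₂ β² + c₁ β + c₀`, for which `c₂ > 0`, `c₀ = Le Pr (γ⁶ - α² σ)` and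
`c₁ c₂ - c₀ = (1 + Pr) Pr ((Pr + Le) (1 + Le) / Pr · γ⁶ - α² η)`. By the Routh–Hurwitz criterion a mode
is stable as soon as both `c₀` and `c₁ c₂ - c₀` are positive. Since `γ⁶ ≥ α² σ_c`, with equality
exactly for the critical modes with `l = 1`, the critical modes are the first to become unstable:
through a zero eigenvalue when `σ` crosses `σ_c` (then `c₀` changes sign), or through a conjugate
pair when `η` crosses `η_c` (then `c₁ c₂ - c₀` changes sign). The identity
`η_c - η = σ_c - σ + κ K` with `κ > 0` (`exists_etaC_sub_cRayleigh`) shows that the first event comes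
first if `K > 0` and the second if `K < 0`.
-/

namespace Thermohaline

/-! ### Zeros of real cubic polynomials -/

/-- The imaginary part of the cubic equation, divided by `Im z`, eliminates `(Im z)²` from its real
part and leaves a real cubic equation for `Re z`. -/
theorem re_eq_of_cubic_zero {c₂ c₁ c₀ : ℝ} {z : ℂ}
    (hz : z ^ 3 + c₂ * z ^ 2 + c₁ * z + c₀ = 0) (him : z.im ≠ 0) :
    8 * z.re ^ 3 + 8 * c₂ * z.re ^ 2 + 2 * (c₁ + c₂ ^ 2) * z.re + (c₁ * c₂ - c₀) = 0 := by
  have hre := congrArg Complex.re hz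
  have hi := congrArg Complex.im hz
  simp [pow_succ] at hre hi
  have h : z.im ^ 2 = 3 * z.re ^ 2 + 2 * c₂ * z.re + c₁ :=
    mul_left_cancel₀ him (by linear_combination -hi)
  linear_combination -hre - (3 * z.re + c₂) * h

theorem re_cubic_of_im_eq_zero {c₂ c₁ c₀ : ℝ} {z : ℂ}
    (hz : z ^ 3 + c₂ * z ^ 2 + c₁ * z + c₀ = 0) (him : z.im = 0) :
    z.re ^ 3 + c₂ * z.re ^ 2 + c₁ * z.re + c₀ = 0 := by
  have hre := congrArg Complex.re hz
  simp [pow_succ, him] at hre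
  linear_combination hre

/-- The Routh–Hurwitz criterion for a cubic polynomial. -/
theorem re_neg_of_cubic_zero {c₂ c₁ c₀ : ℝ} (h₂ : 0 < c₂) (h₀ : 0 < c₀) (h : c₀ < c₁ * c₂) {z : ℂ}
    (hz : z ^ 3 + c₂ * z ^ 2 + c₁ * z + c₀ = 0) : z.re < 0 := by
  have h₁ : 0 < c₁ := pos_of_mul_pos_left (h₀.trans h) h₂.le
  by_contra! hx
  by_cases him : z.im = 0
  · have := re_cubic_of_im_eq_zero hz him
    have : 0 < z.re ^ 3 + c₂ * z.re ^ 2 + c₁ * z.re + c₀ := by positivity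
    linarith
  · have := re_eq_of_cubic_zero hz him
    have h' : 0 < c₁ * c₂ - c₀ := by linarith
    have : 0 < 8 * z.re ^ 3 + 8 * c₂ * z.re ^ 2 + 2 * (c₁ + c₂ ^ 2) * z.re + (c₁ * c₂ - c₀) := by
      positivity
    linarith

theorem eq_zero_or_re_neg_of_cubic_zero {c₂ c₁ : ℝ} (h₂ : 0 < c₂) (h₁ : 0 < c₁) {z : ℂ}
    (hz : z ^ 3 + c₂ * z ^ 2 + c₁ * z = 0) : z = 0 ∨ z.re < 0 := by
  refine or_iff_not_imp_left.2 fun hne => ?_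
  have hq : z ^ 2 + c₂ * z + c₁ = 0 := mul_left_cancel₀ hne (by linear_combination hz)
  have hre := congrArg Complex.re hq
  have hi := congrArg Complex.im hq
  simp [pow_succ] at hre hi
  by_contra! hx
  have h0 : z.im = 0 := by
    have : z.im * (2 * z.re + c₂) = 0 := by linear_combination hi
    rcases mul_eq_zero.1 this with h | h
    · exact h
    · linarith
  rw [h0] at hre
  nlinarith [mul_nonneg h₂.le hx, mul_self_nonneg z.re]

/-- The zeros of the monic real cubic polynomial with coefficients `c₂`, `c₁`, `c₀`, with
multiplicity and in the order of decreasing real parts. -/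
structure OrderedCubicZeros (c₂ c₁ c₀ : ℝ) (b : Fin 3 → ℂ) : Prop where
  factor : ∀ z : ℂ, z ^ 3 + c₂ * z ^ 2 + c₁ * z + c₀ = (z - b 0) * (z - b 1) * (z - b 2)
  order₁ : (b 1).re ≤ (b 0).re
  order₂ : (b 2).re ≤ (b 1).re

namespace OrderedCubicZeros

variable {c₂ c₁ c₀ : ℝ} {b : Fin 3 → ℂ}

theorem vieta (h : OrderedCubicZeros c₂ c₁ c₀ b) :
    b 0 + b 1 + b 2 = -c₂ ∧ b 0 * b 1 + b 0 * b 2 + b 1 * b 2 = c₁ ∧ b 0 * b 1 * b 2 = -c₀ := by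
  have h0 := h.factor 0
  have h1 := h.factor 1
  have h2 := h.factor (-1)
  refine ⟨?_, ?_, ?_⟩
  · linear_combination (1 / 2) * h1 + (1 / 2) * h2 - h0
  · linear_combination (-1 / 2) * h1 + (1 / 2) * h2
  · linear_combination h0

theorem isZero (h : OrderedCubicZeros c₂ c₁ c₀ b) (i : Fin 3) :
    b i ^ 3 + c₂ * b i ^ 2 + c₁ * b i + c₀ = 0 := by
  rw [h.factor]
  fin_cases i <;> simp

theorem eq_of_zero (h : OrderedCubicZeros c₂ c₁ c₀ b) {z : ℂ}
    (hz : z ^ 3 + c₂ * z ^ 2 + c₁ * z + c₀ = 0) : z = b 0 ∨ z = b 1 ∨ z = b 2 := by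
  rw [h.factor] at hz
  simpa [sub_eq_zero, or_assoc] using hz

theorem star_eq (h : OrderedCubicZeros c₂ c₁ c₀ b) (i : Fin 3) :
    star (b i) = b 0 ∨ star (b i) = b 1 ∨ star (b i) = b 2 := by
  apply h.eq_of_zero
  have := congrArg star (h.isZero i)
  simpa using this

/-- Either all zeros are real, or two are nonreal and conjugate and the third is real. -/
theorem real_or_conj (h : OrderedCubicZeros c₂ c₁ c₀ b) :
    ((b 0).im = 0 ∧ (b 1).im = 0 ∧ (b 2).im = 0) ∨
    ((b 0).im ≠ 0 ∧ b 1 = star (b 0) ∧ (b 2).im = 0) ∨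
    ((b 0).im ≠ 0 ∧ b 2 = star (b 0) ∧ (b 1).im = 0) ∨
    ((b 1).im ≠ 0 ∧ b 2 = star (b 1) ∧ (b 0).im = 0) := by
  have hs := congrArg Complex.im h.vieta.1
  simp only [Complex.add_im, Complex.neg_im, Complex.ofReal_im, neg_zero] at hs
  by_cases h0 : (b 0).im = 0
  · by_cases h1 : (b 1).im = 0
    · left; exact ⟨h0, h1, by linarith⟩
    · rcases h.star_eq 1 with e | e | e
      · have := congrArg Complex.im e
        simp at this
        exact absurd (by linarith) h1
      · have := congrArg Complex.im e
        simp at this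
        exact absurd (by linarith) h1
      · exact Or.inr (Or.inr (Or.inr ⟨h1, e.symm, h0⟩))
  · rcases h.star_eq 0 with e | e | e
    · have := congrArg Complex.im e
      simp at this
      exact absurd (by linarith) h0
    · refine Or.inr (Or.inl ⟨h0, e.symm, ?_⟩)
      have := congrArg Complex.im e
      simp at this
      linarith
    · refine Or.inr (Or.inr (Or.inl ⟨h0, e.symm, ?_⟩))
      have := congrArg Complex.im e
      simp at this
      linarith

/-- If `b 0` is not real, the other zeros are its conjugate and a real one that is not larger than
`Re (b 0)`. -/
theorem exists_real_le (h : OrderedCubicZeros c₂ c₁ c₀ b) (h0 : (b 0).im ≠ 0) :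
    ∃ y : ℝ, y ≤ (b 0).re ∧ 2 * (b 0).re + y = -c₂ ∧ Complex.normSq (b 0) * y = -c₀ ∧
      ∀ t : ℝ, t ^ 3 + c₂ * t ^ 2 + c₁ * t + c₀
        = (t - y) * ((t - (b 0).re) ^ 2 + (b 0).im ^ 2) := by
  have key : ∀ y : ℂ, y.im = 0 → y.re ≤ (b 0).re →
      (∀ z : ℂ, z ^ 3 + c₂ * z ^ 2 + c₁ * z + c₀ = (z - b 0) * (z - star (b 0)) * (z - y)) →
      ∃ y : ℝ, y ≤ (b 0).re ∧ 2 * (b 0).re + y = -c₂ ∧ Complex.normSq (b 0) * y = -c₀ ∧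
      ∀ t : ℝ, t ^ 3 + c₂ * t ^ 2 + c₁ * t + c₀
        = (t - y) * ((t - (b 0).re) ^ 2 + (b 0).im ^ 2) := by
    intro y hy hle hf
    have hp : ∀ t : ℝ, t ^ 3 + c₂ * t ^ 2 + c₁ * t + c₀
        = (t - y.re) * ((t - (b 0).re) ^ 2 + (b 0).im ^ 2) := by
      intro t
      have := congrArg Complex.re (hf t)
      simp [pow_succ, hy] at this
      linear_combination this
    refine ⟨y.re, hle, ?_, ?_, hp⟩
    · linear_combination hp 1 / 2 + hp (-1) / 2 - hp 0
    · rw [Complex.normSq_apply]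
      linear_combination hp 0
  rcases h.real_or_conj with h' | h' | h' | h'
  · exact absurd h'.1 h0
  · refine key (b 2) h'.2.2 (h.order₂.trans h.order₁) fun z => ?_
    rw [h.factor, h'.2.1]
  · refine key (b 1) h'.2.2 h.order₁ fun z => ?_
    rw [h.factor, h'.2.1]
    ring
  · exact absurd h'.2.2 h0

theorem eq_zero_of_const_eq_zero (h : OrderedCubicZeros c₂ c₁ 0 b) (h₂ : 0 < c₂) (h₁ : 0 < c₁) :
    b 0 = 0 ∧ (b 1).re < 0 ∧ (b 2).re < 0 := by
  have hz : ∀ i, b i = 0 ∨ (b i).re < 0 := fun i =>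
    eq_zero_or_re_neg_of_cubic_zero h₂ h₁ (by simpa using h.isZero i)
  obtain ⟨-, e₂, e₃⟩ := h.vieta
  have h0 : b 0 = 0 := by
    rcases hz 0 with h0 | h0
    · exact h0
    · have n0 : b 0 ≠ 0 := fun e => by simp [e] at h0
      have n1 : b 1 ≠ 0 := fun e => by have := h.order₁; simp [e] at this; linarith
      have n2 : b 2 ≠ 0 := fun e => by
        have := h.order₁; have := h.order₂; simp [e] at this; linarith
      simp [n0, n1, n2] at e₃
  have hc : (c₁ : ℂ) ≠ 0 := by exact_mod_cast h₁.ne'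
  simp only [h0, zero_mul, zero_add] at e₂
  refine ⟨h0, (hz 1).resolve_left fun e => ?_, (hz 2).resolve_left fun e => ?_⟩
  · simp [e] at e₂; exact hc e₂.symm
  · simp [e] at e₂; exact hc e₂.symm

theorem real_pos_of_const_neg (h : OrderedCubicZeros c₂ c₁ c₀ b) (h₂ : 0 < c₂) (h₀ : c₀ < 0) :
    (b 0).im = 0 ∧ 0 < (b 0).re := by
  have him : (b 0).im = 0 := by
    by_contra h0
    obtain ⟨y, hy, hs, hp, -⟩ := h.exists_real_le h0
    have : 0 < y := pos_of_mul_pos_right (by linarith) (Complex.normSq_nonneg (b 0))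
    linarith
  refine ⟨him, ?_⟩
  by_contra! hle
  have e₃ := congrArg Complex.re h.vieta.2.2
  have o1 := h.order₁
  have o2 := h.order₂
  have hn : 0 ≤ (b 1).re * (b 2).re - (b 1).im * (b 2).im := by
    rcases h.real_or_conj with h' | h' | h' | h'
    · rw [h'.2.1]
      nlinarith
    · exact absurd him h'.1
    · exact absurd him h'.1
    · rw [h'.2.1]
      simp
      nlinarith [mul_self_nonneg (b 1).re, mul_self_nonneg (b 1).im]
  simp [him] at e₃
  nlinarith

/-- A nonreal pair with the largest real part would put the real zero below the mean `-c₂ / 3` of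
the zeros, where the sign at `-δ` excludes it. -/
theorem im_eq_zero_of_neg (h : OrderedCubicZeros c₂ c₁ c₀ b) {δ : ℝ} (hδ : 3 * δ ≤ c₂)
    (hf : (-δ) ^ 3 + c₂ * (-δ) ^ 2 + c₁ * (-δ) + c₀ < 0) : (b 0).im = 0 := by
  by_contra h0
  obtain ⟨y, hy, hs, -, hp⟩ := h.exists_real_le h0
  rw [hp] at hf
  have : 0 < (-δ - (b 0).re) ^ 2 + (b 0).im ^ 2 := by positivity
  have : -δ - y < 0 := by
    by_contra! hc
    have := mul_nonneg hc this.le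
    linarith
  linarith

theorem re_pos_of_lt (h : OrderedCubicZeros c₂ c₁ c₀ b) (hlt : c₁ * c₂ < c₀) : 0 < (b 0).re := by
  by_contra! hle
  obtain ⟨e₁, e₂, e₃⟩ := h.vieta
  have key : (b 0 + b 1) * ((b 0 + b 2) * (b 1 + b 2)) = ((c₀ - c₁ * c₂ : ℝ) : ℂ) := by
    push_cast
    linear_combination (-(c₂ : ℂ)) * e₂ + (b 0 * b 1 + b 0 * b 2 + b 1 * b 2) * e₁ - e₃
  have hr := congrArg Complex.re key
  have o1 := h.order₁
  have o2 := h.order₂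
  simp at hr
  have a1 : (b 0).re + (b 1).re ≤ 0 := by linarith
  have a2 : (b 0).re + (b 2).re ≤ 0 := by linarith
  have a3 : (b 1).re + (b 2).re ≤ 0 := by linarith
  rcases h.real_or_conj with ⟨i0, i1, i2⟩ | h' | h' | h'
  · rw [i0, i1, i2] at hr
    nlinarith [mul_nonneg_of_nonpos_of_nonpos a2 a3]
  · rw [h'.2.1, h'.2.2] at hr
    simp at hr
    rw [h'.2.1] at a1
    simp at a1
    nlinarith [mul_nonneg (neg_nonneg.2 a1) (add_nonneg (mul_self_nonneg ((b 0).re + (b 2).re))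
      (mul_self_nonneg (b 0).im))]
  · rw [h'.2.1, h'.2.2] at hr
    simp at hr
    rw [h'.2.1] at a2
    simp at a2
    nlinarith [mul_nonneg (neg_nonneg.2 a2) (add_nonneg (mul_self_nonneg ((b 0).re + (b 1).re))
      (mul_self_nonneg (b 0).im))]
  · rw [h'.2.1, h'.2.2] at hr
    simp at hr
    rw [h'.2.1] at a3
    simp at a3
    nlinarith [mul_nonneg (neg_nonneg.2 a3) (add_nonneg (mul_self_nonneg ((b 0).re + (b 1).re))
      (mul_self_nonneg (b 1).im))]

/-- Near the stability boundary `c₀ = c₁ c₂` every real zero is close to `-c₂`; since the sum of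
the zeros is `-c₂`, only one of them can be real, and it has the smallest real part. -/
theorem conj_of_near (h : OrderedCubicZeros c₂ c₁ c₀ b) (h₂ : 0 < c₂)
    (hn : |c₀ - c₁ * c₂| < c₁ * c₂ / 3) :
    (b 0).im ≠ 0 ∧ b 1 = star (b 0) ∧ (b 2).im = 0 := by
  have hc : 0 < c₁ * c₂ := by have := (abs_nonneg _).trans_lt hn; linarith
  have h₁ : 0 < c₁ := pos_of_mul_pos_left hc h₂.le
  have hreal : ∀ i, (b i).im = 0 → |(b i).re + c₂| < c₂ / 3 := by
    intro i hi
    have hz := re_cubic_of_im_eq_zero (h.isZero i) hi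
    have e : ((b i).re + c₂) * ((b i).re ^ 2 + c₁) = -(c₀ - c₁ * c₂) := by linear_combination hz
    have e' := congrArg abs e
    rw [abs_neg, abs_mul, abs_of_pos (by positivity : 0 < (b i).re ^ 2 + c₁)] at e'
    by_contra! hge
    have : c₂ / 3 * c₁ ≤ |(b i).re + c₂| * ((b i).re ^ 2 + c₁) := by gcongr; nlinarith
    linarith
  have hs := congrArg Complex.re h.vieta.1
  simp at hs
  have o1 := h.order₁
  have o2 := h.order₂
  rcases h.real_or_conj with ⟨i0, i1, i2⟩ | h' | h' | h'
  · have := (abs_lt.1 (hreal 0 i0)).2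
    have := (abs_lt.1 (hreal 1 i1)).2
    have := (abs_lt.1 (hreal 2 i2)).2
    linarith
  · exact h'
  · have := (abs_lt.1 (hreal 1 h'.2.2)).2
    have := congrArg Complex.re h'.2.1
    simp at this
    linarith
  · have := (abs_lt.1 (hreal 0 h'.2.2)).2
    linarith

theorem re_of_eq (h : OrderedCubicZeros c₂ c₁ c₀ b) (h₂ : 0 < c₂) (h₁ : 0 < c₁)
    (he : c₀ = c₁ * c₂) : (b 0).re = 0 ∧ (b 1).re = 0 ∧ (b 2).re < 0 := by
  obtain ⟨-, h1, h2⟩ := h.conj_of_near h₂ (by rw [he, sub_self, abs_zero]; positivity)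
  have hz := re_cubic_of_im_eq_zero (h.isZero 2) h2
  have e : ((b 2).re + c₂) * ((b 2).re ^ 2 + c₁) = 0 := by rw [he] at hz; linear_combination hz
  have e2 : (b 2).re + c₂ = 0 := (mul_eq_zero.1 e).resolve_right (by positivity)
  have hs := congrArg Complex.re h.vieta.1
  have h1' := congrArg Complex.re h1
  simp at hs h1'
  refine ⟨?_, ?_, ?_⟩ <;> linarith

end OrderedCubicZeros

/-- On the stability boundary `c₀ = c₁ c₂` the cubic is `(z² + c₁) (z + c₂)`. -/
theorem exists_orderedCubicZeros {c₂ c₁ c₀ : ℝ} (h₂ : 0 < c₂) (h₁ : 0 < c₁) (he : c₀ = c₁ * c₂) :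
    ∃ b, OrderedCubicZeros c₂ c₁ c₀ b := by
  refine ⟨![Complex.I * √c₁, -(Complex.I * √c₁), -c₂], ?_, ?_, ?_⟩
  · intro z
    have hs : ((√c₁ : ℝ) : ℂ) ^ 2 = c₁ := by exact_mod_cast Real.sq_sqrt h₁.le
    simp [he]
    linear_combination (-(z + c₂)) * hs +
      (((√c₁ : ℝ) : ℂ) ^ 2 * (z + c₂)) * (Complex.I_sq)
  · simp
  · simpa using h₂.le

/-! ### Products of functions of one coordinate -/

/-- The function `x ↦ f₀(x₀) f₁(x₁) f₂(x₂)`. -/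
noncomputable def prodFn (f : Fin 3 → ℝ → ℝ) (x : Fin 3 → ℝ) : ℝ := ∏ m, f m (x m)

theorem contDiff_prodFn {f : Fin 3 → ℝ → ℝ} (hf : ∀ m, ContDiff ℝ ∞ (f m)) :
    ContDiff ℝ ∞ (prodFn f) :=
  contDiff_prod fun m _ => (hf m).comp (contDiff_apply ℝ ℝ m)

theorem pderiv_prodFn {f : Fin 3 → ℝ → ℝ} (hf : ∀ m, ContDiff ℝ ∞ (f m)) (i : Fin 3) :
    pderiv i (prodFn f) = prodFn (Function.update f i (deriv (f i))) := by
  ext x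
  have hd : ∀ m, HasFDerivAt (fun y : Fin 3 → ℝ => f m (y m))
      (deriv (f m) (x m) • ContinuousLinearMap.proj (R := ℝ) (φ := fun _ : Fin 3 => ℝ) m) x :=
    fun m => (((hf m).differentiable (by simp)).differentiableAt.hasDerivAt).comp_hasFDerivAt x
      (ContinuousLinearMap.proj (R := ℝ) (φ := fun _ : Fin 3 => ℝ) m).hasFDerivAt
  have h : HasFDerivAt (fun y : Fin 3 → ℝ => f 0 (y 0) * f 1 (y 1) * f 2 (y 2)) _ x :=
    ((hd 0).mul (hd 1)).mul (hd 2)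
  have e : prodFn f = fun y => f 0 (y 0) * f 1 (y 1) * f 2 (y 2) := by
    ext y; simp [prodFn, Fin.prod_univ_three]
  rw [pderiv, e, h.fderiv]
  fin_cases i <;> simp [prodFn, Fin.prod_univ_three, Function.update] <;> ring

theorem contDiff_pderiv {φ : (Fin 3 → ℝ) → ℝ} (hφ : ContDiff ℝ ∞ φ) (i : Fin 3) :
    ContDiff ℝ ∞ (pderiv i φ) :=
  ((hφ.fderiv_right (m := ∞) (by simp)).clm_apply contDiff_const :)

/-! ### Trigonometric modes -/

/-- `sin (a y)` if `s = true`, and `cos (a y)` if `s = false`. -/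
noncomputable def trig (s : Bool) (a y : ℝ) : ℝ := if s then Real.sin (a * y) else Real.cos (a * y)

theorem trig_true (a : ℝ) : trig true a = fun y => Real.sin (a * y) := rfl

theorem trig_false (a : ℝ) : trig false a = fun y => Real.cos (a * y) := rfl

theorem contDiff_trig (s : Bool) (a : ℝ) : ContDiff ℝ ∞ (trig s a) := by
  cases s
  · rw [trig_false]; fun_prop
  · rw [trig_true]; fun_prop

theorem deriv_trig (s : Bool) (a : ℝ) :
    deriv (trig s a) = fun y => (if s then a else -a) * trig (!s) a y := by
  ext y
  cases s
  · have : HasDerivAt (fun y => Real.cos (a * y)) (-Real.sin (a * y) * (a * 1)) y :=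
      ((hasDerivAt_id y).const_mul a).cos
    simp [trig_false, trig_true, this.deriv, mul_comm]
  · have : HasDerivAt (fun y => Real.sin (a * y)) (Real.cos (a * y) * (a * 1)) y :=
      ((hasDerivAt_id y).const_mul a).sin
    simp [trig_false, trig_true, this.deriv, mul_comm]

/-- The wave number `n_m π / L_m` of the mode `n` in the direction `m`. -/
noncomputable def freq (L₁ L₂ : ℝ) (n : Fin 3 → ℕ) (m : Fin 3) : ℝ :=
  n m * Real.pi / side L₁ L₂ m

/-- The product of `sin (n_m π x_m / L_m)` over the directions with `s m = true` and of
`cos (n_m π x_m / L_m)` over the others. -/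
noncomputable def mode (L₁ L₂ : ℝ) (s : Fin 3 → Bool) (n : Fin 3 → ℕ) : (Fin 3 → ℝ) → ℝ :=
  prodFn fun m => trig (s m) (freq L₁ L₂ n m)

theorem contDiff_mode (L₁ L₂ : ℝ) (s : Fin 3 → Bool) (n : Fin 3 → ℕ) :
    ContDiff ℝ ∞ (mode L₁ L₂ s n) :=
  contDiff_prodFn fun _ => contDiff_trig _ _

theorem pderiv_mode (L₁ L₂ : ℝ) (s : Fin 3 → Bool) (n : Fin 3 → ℕ) (i : Fin 3) :
    pderiv i (mode L₁ L₂ s n) = fun x => (if s i then freq L₁ L₂ n i else -freq L₁ L₂ n i) *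
      mode L₁ L₂ (Function.update s i (!s i)) n x := by
  rw [mode, pderiv_prodFn fun _ => contDiff_trig _ _]
  ext x
  rw [deriv_trig]
  fin_cases i <;> simp [mode, prodFn, Fin.prod_univ_three, Function.update] <;> ring_nf

theorem pderiv_const_mul {φ : (Fin 3 → ℝ) → ℝ} (hφ : ContDiff ℝ ∞ φ) (c : ℝ) (i : Fin 3) :
    pderiv i (fun x => c * φ x) = fun x => c * pderiv i φ x := by
  ext x
  have : DifferentiableAt ℝ φ x := (hφ.differentiable (by simp)).differentiableAt
  simp [pderiv, fderiv_const_mul this]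

theorem pderiv_pderiv_mode (L₁ L₂ : ℝ) (s : Fin 3 → Bool) (n : Fin 3 → ℕ) (i : Fin 3) :
    pderiv i (pderiv i (mode L₁ L₂ s n)) =
      fun x => -freq L₁ L₂ n i ^ 2 * mode L₁ L₂ s n x := by
  rw [pderiv_mode, pderiv_const_mul (contDiff_mode _ _ _ _), pderiv_mode]
  ext x
  simp only [Function.update_self, Function.update_idem, Bool.not_not, Function.update_eq_self]
  cases s i <;> simp <;> ring

theorem mode_eq_zero_of_face {L₁ L₂ : ℝ} (hL₁ : 0 < L₁) (hL₂ : 0 < L₂) {s : Fin 3 → Bool}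
    (n : Fin 3 → ℕ) {i : Fin 3} (hs : s i = true) {x : Fin 3 → ℝ}
    (hx : x i = 0 ∨ x i = side L₁ L₂ i) : mode L₁ L₂ s n x = 0 := by
  have hne : side L₁ L₂ i ≠ 0 := by fin_cases i <;> simp [side, hL₁.ne', hL₂.ne']
  rw [mode, prodFn]
  refine Finset.prod_eq_zero (Finset.mem_univ i) ?_
  rcases hx with hx | hx
  · simp [trig, hs, hx]
  · simp [trig, hs, hx, freq, hne, Real.sin_nat_mul_pi]

/-! ### Integration by parts on the box for smooth functions -/

theorem box_eq_pi (L₁ L₂ : ℝ) : box L₁ L₂ = Set.univ.pi fun i => Set.Ioo 0 (side L₁ L₂ i) := by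
  ext x; simp [box]

theorem side_pos {L₁ L₂ : ℝ} (hL₁ : 0 < L₁) (hL₂ : 0 < L₂) (i : Fin 3) : 0 < side L₁ L₂ i := by
  fin_cases i <;> simp [side, hL₁, hL₂]

theorem isOpen_box (L₁ L₂ : ℝ) : IsOpen (box L₁ L₂) := by
  rw [box_eq_pi]; exact isOpen_set_pi Set.finite_univ fun _ _ => isOpen_Ioo

theorem measurableSet_box (L₁ L₂ : ℝ) : MeasurableSet (box L₁ L₂) := (isOpen_box _ _).measurableSet

theorem box_ae_eq_Icc (L₁ L₂ : ℝ) : box L₁ L₂ =ᵐ[volume] Set.Icc 0 (side L₁ L₂) := by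
  rw [box_eq_pi]
  exact Measure.univ_pi_Ioo_ae_eq_Icc (f := fun _ => (0 : ℝ)) (g := side L₁ L₂)

theorem box_subset_Icc (L₁ L₂ : ℝ) : box L₁ L₂ ⊆ Set.Icc 0 (side L₁ L₂) :=
  fun _ hx => ⟨fun i => (hx i).1.le, fun i => (hx i).2.le⟩

theorem continuous_integrableOn_box (L₁ L₂ : ℝ) {E : Type*} [NormedAddCommGroup E]
    {f : (Fin 3 → ℝ) → E} (hf : Continuous f) : IntegrableOn f (box L₁ L₂) :=
  (hf.continuousOn.integrableOn_compact isCompact_Icc).mono_set (box_subset_Icc L₁ L₂)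

theorem integral_pderiv_eq_zero {L₁ L₂ : ℝ} (hL₁ : 0 < L₁) (hL₂ : 0 < L₂) {φ : (Fin 3 → ℝ) → ℝ}
    (hφ : ContDiff ℝ ∞ φ) (i : Fin 3) (h0 : ∀ x, x i = 0 ∨ x i = side L₁ L₂ i → φ x = 0) :
    ∫ x in box L₁ L₂, pderiv i φ x = 0 := by
  rw [setIntegral_congr_set (box_ae_eq_Icc L₁ L₂)]
  have hle : (0 : Fin 3 → ℝ) ≤ side L₁ L₂ := fun i => (side_pos hL₁ hL₂ i).le
  have hs : ∀ x, ∑ m, (if m = i then fderiv ℝ φ x else 0) (Pi.single m 1) = pderiv i φ x := by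
    intro x
    rw [Finset.sum_eq_single i (fun m _ hm => by simp [hm]) (by simp)]
    simp [pderiv]
  have h := integral_divergence_of_hasFDerivAt_off_countable' (0 : Fin 3 → ℝ) (side L₁ L₂) hle
    (fun m => if m = i then φ else 0) (fun m x => if m = i then fderiv ℝ φ x else 0) ∅
    Set.countable_empty
    (fun m => by
      split_ifs
      · exact hφ.continuous.continuousOn
      · exact continuousOn_const)
    (fun x _ m => by
      by_cases hm : m = i
      · simpa [hm] using ((hφ.differentiable (by simp)).differentiableAt (x := x)).hasFDerivAt
      · simpa only [hm, if_false] using hasFDerivAt_zero x)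
    (by
      simp only [hs]
      exact (contDiff_pderiv hφ i).continuous.continuousOn.integrableOn_compact isCompact_Icc)
  simp only [hs] at h
  rw [h]
  refine Finset.sum_eq_zero fun m _ => ?_
  by_cases hm : m = i
  · subst hm
    simp [h0]
  · simp [hm]

/-- Integration by parts in the direction `i`, if the boundary terms vanish. -/
theorem integral_mul_pderiv {L₁ L₂ : ℝ} (hL₁ : 0 < L₁) (hL₂ : 0 < L₂) {φ ψ : (Fin 3 → ℝ) → ℝ}
    (hφ : ContDiff ℝ ∞ φ) (hψ : ContDiff ℝ ∞ ψ) (i : Fin 3)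
    (h0 : ∀ x, x i = 0 ∨ x i = side L₁ L₂ i → φ x * ψ x = 0) :
    ∫ x in box L₁ L₂, φ x * pderiv i ψ x = -∫ x in box L₁ L₂, pderiv i φ x * ψ x := by
  have h := integral_pderiv_eq_zero hL₁ hL₂ (hφ.mul hψ) i h0
  have e : ∀ x, pderiv i (φ * ψ) x = φ x * pderiv i ψ x + pderiv i φ x * ψ x := by
    intro x
    have h1 : DifferentiableAt ℝ φ x := (hφ.differentiable (by simp)).differentiableAt
    have h2 : DifferentiableAt ℝ ψ x := (hψ.differentiable (by simp)).differentiableAt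
    simp [pderiv, fderiv_mul h1 h2]
    ring
  have h' : ∫ x in box L₁ L₂, (φ x * pderiv i ψ x + pderiv i φ x * ψ x) = 0 := by
    rw [← h]; exact integral_congr_ae (Filter.Eventually.of_forall fun x => (e x).symm)
  rw [integral_add] at h'
  · linarith
  · exact continuous_integrableOn_box _ _
      (hφ.continuous.mul (contDiff_pderiv hψ i).continuous)
  · exact continuous_integrableOn_box _ _
      ((contDiff_pderiv hφ i).continuous.mul hψ.continuous)

/-! ### Eigenfunctions from the zeros of the cubic -/

theorem memLp_box (L₁ L₂ : ℝ) {f : (Fin 3 → ℝ) → ℂ} (hf : Continuous f) :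
    MemLp f 2 (volume.restrict (box L₁ L₂)) := by
  obtain ⟨C, hC⟩ := (isCompact_Icc (a := (0 : Fin 3 → ℝ)) (b := side L₁ L₂)).exists_bound_of_continuousOn
    hf.continuousOn
  have : IsFiniteMeasure (volume.restrict (box L₁ L₂)) :=
    ⟨by
      rw [Measure.restrict_apply_univ]
      exact (measure_mono (box_subset_Icc L₁ L₂)).trans_lt isCompact_Icc.measure_lt_top⟩
  refine MemLp.of_bound hf.aestronglyMeasurable C ?_
  filter_upwards [ae_restrict_mem (measurableSet_box L₁ L₂)] with x hx
  exact hC x (box_subset_Icc _ _ hx)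

theorem integral_const_mul_pderiv {L₁ L₂ : ℝ} (hL₁ : 0 < L₁) (hL₂ : 0 < L₂)
    (c : ℂ) {φ ψ : (Fin 3 → ℝ) → ℝ} (hφ : ContDiff ℝ ∞ φ)
    (hψ : ContDiff ℝ ∞ ψ) (i : Fin 3)
    (h0 : ∀ x, x i = 0 ∨ x i = side L₁ L₂ i → φ x * ψ x = 0) :
    ∫ x in box L₁ L₂, (c * φ x) * (pderiv i ψ x : ℂ)
      = -∫ x in box L₁ L₂, (c * pderiv i φ x) * (ψ x : ℂ) := by
  simp only [mul_assoc, integral_const_mul, ← Complex.ofReal_mul]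
  rw [integral_complex_ofReal, integral_complex_ofReal, integral_mul_pderiv hL₁ hL₂ hφ hψ i h0]
  simp

theorem hasWeakPartial_const_mul {L₁ L₂ : ℝ} (hL₁ : 0 < L₁) (hL₂ : 0 < L₂)
    (c : ℂ) {φ : (Fin 3 → ℝ) → ℝ} (hφ : ContDiff ℝ ∞ φ) (i : Fin 3) :
    HasWeakPartial (box L₁ L₂) i (fun x => c * φ x) (fun x => c * pderiv i φ x) := by
  intro ψ hψ _ hs
  refine integral_const_mul_pderiv hL₁ hL₂ c hφ hψ i fun x hx => ?_
  have : x ∉ box L₁ L₂ := fun h => by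
    rcases hx with hx | hx
    · exact (h i).1.ne' hx
    · exact (h i).2.ne hx
  rw [image_eq_zero_of_notMem_tsupport fun h => this (hs h), mul_zero]

theorem vanishesOnFaces_const_mul {L₁ L₂ : ℝ} (hL₁ : 0 < L₁) (hL₂ : 0 < L₂)
    (c : ℂ) {φ : (Fin 3 → ℝ) → ℝ} (hφ : ContDiff ℝ ∞ φ) (i : Fin 3)
    (h0 : ∀ x, x i = 0 ∨ x i = side L₁ L₂ i → φ x = 0) :
    VanishesOnFaces (box L₁ L₂) i (fun x => c * φ x) (fun x => c * pderiv i φ x) :=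
  fun _ hψ => integral_const_mul_pderiv hL₁ hL₂ c hφ hψ i fun x hx => by rw [h0 x hx, zero_mul]

theorem continuous_const_mul (c : ℂ) {φ : (Fin 3 → ℝ) → ℝ} (hφ : ContDiff ℝ ∞ φ) :
    Continuous fun x => c * (φ x : ℂ) := by
  have := hφ.continuous
  fun_prop

/-- A complex multiple of a smooth real function, as an element of `H¹` of the box. -/
noncomputable def smoothH1 {L₁ L₂ : ℝ} (hL₁ : 0 < L₁) (hL₂ : 0 < L₂) (c : ℂ)
    (φ : (Fin 3 → ℝ) → ℝ) (hφ : ContDiff ℝ ∞ φ) : SobolevH1 (box L₁ L₂) where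
  val x := c * φ x
  grad i x := c * pderiv i φ x
  memLp_val := memLp_box _ _ (continuous_const_mul c hφ)
  memLp_grad i := memLp_box _ _ (continuous_const_mul c (contDiff_pderiv hφ i))
  weak_grad i := hasWeakPartial_const_mul hL₁ hL₂ c hφ i

/-- A complex multiple of a smooth real function, as an element of `H²` of the box. -/
noncomputable def smoothH2 {L₁ L₂ : ℝ} (hL₁ : 0 < L₁) (hL₂ : 0 < L₂) (c : ℂ)
    (φ : (Fin 3 → ℝ) → ℝ) (hφ : ContDiff ℝ ∞ φ) : SobolevH2 (box L₁ L₂) where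
  toSobolevH1 := smoothH1 hL₁ hL₂ c φ hφ
  hess i j x := c * pderiv j (pderiv i φ) x
  memLp_hess i j := memLp_box _ _ (continuous_const_mul c (contDiff_pderiv (contDiff_pderiv hφ i) j))
  weak_hess i j := hasWeakPartial_const_mul hL₁ hL₂ c (contDiff_pderiv hφ i) j

/-- A complex multiple of a mode, as an element of `H²` of the box. -/
noncomputable def modeH2 {L₁ L₂ : ℝ} (hL₁ : 0 < L₁) (hL₂ : 0 < L₂) (c : ℂ) (s : Fin 3 → Bool)
    (n : Fin 3 → ℕ) : SobolevH2 (box L₁ L₂) :=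
  smoothH2 hL₁ hL₂ c (mode L₁ L₂ s n) (contDiff_mode L₁ L₂ s n)

theorem alphaSq_eq (L₁ L₂ : ℝ) (n : Fin 3 → ℕ) :
    alphaSq L₁ L₂ (n 0) (n 1) = freq L₁ L₂ n 0 ^ 2 + freq L₁ L₂ n 1 ^ 2 := by
  simp only [alphaSq, freq, side]
  simp
  ring

theorem alphaSq_pos {L₁ L₂ : ℝ} (hL₁ : 0 < L₁) (hL₂ : 0 < L₂) {j k : ℕ} (hjk : j ≠ 0 ∨ k ≠ 0) :
    0 < alphaSq L₁ L₂ j k := by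
  rw [alphaSq]
  rcases hjk with h | h <;> positivity

theorem gammaSq_eq (L₁ L₂ : ℝ) (n : Fin 3 → ℕ) :
    gammaSq L₁ L₂ (n 0) (n 1) (n 2) = ∑ i, freq L₁ L₂ n i ^ 2 := by
  rw [gammaSq, alphaSq_eq, Fin.sum_univ_three]
  simp [freq, side]
  ring

theorem modeH2_dirichlet {L₁ L₂ : ℝ} (hL₁ : 0 < L₁) (hL₂ : 0 < L₂)
    (c : ℂ) {s : Fin 3 → Bool} (n : Fin 3 → ℕ) {i : Fin 3} (hs : s i = true) :
    (modeH2 hL₁ hL₂ c s n).Dirichlet i :=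
  vanishesOnFaces_const_mul hL₁ hL₂ c (contDiff_mode L₁ L₂ s n) i
    fun _ hx => mode_eq_zero_of_face hL₁ hL₂ n hs hx

theorem modeH2_neumann {L₁ L₂ : ℝ} (hL₁ : 0 < L₁) (hL₂ : 0 < L₂)
    (c : ℂ) {s : Fin 3 → Bool} (n : Fin 3 → ℕ) {i : Fin 3} (hs : s i = false) :
    (modeH2 hL₁ hL₂ c s n).Neumann i := by
  refine vanishesOnFaces_const_mul hL₁ hL₂ c (contDiff_pderiv (contDiff_mode L₁ L₂ s n) i) i
    fun x hx => ?_
  simp [pderiv_mode, mode_eq_zero_of_face hL₁ hL₂ n (s := Function.update s i (!s i)) (i := i)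
    (by simp [hs]) hx]

theorem modeH2_lap {L₁ L₂ : ℝ} (hL₁ : 0 < L₁) (hL₂ : 0 < L₂)
    (c : ℂ) (s : Fin 3 → Bool) (n : Fin 3 → ℕ) (x : Fin 3 → ℝ) :
    (modeH2 hL₁ hL₂ c s n).lap x
      = -(gammaSq L₁ L₂ (n 0) (n 1) (n 2) : ℂ) * (c * mode L₁ L₂ s n x) := by
  simp only [SobolevH2.lap, modeH2, smoothH2, pderiv_pderiv_mode, gammaSq_eq, Fin.sum_univ_three]
  push_cast
  ring

/-- The mode type of the `i`-th velocity component: sine in the direction `i`, cosine in the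
others. The temperature and the salinity are of type `velType 2`. -/
def velType (i : Fin 3) : Fin 3 → Bool := fun m => decide (m = i)

theorem exists_mode_ne_zero {L₁ L₂ : ℝ} (hL₁ : 0 < L₁) (hL₂ : 0 < L₂) {s : Fin 3 → Bool}
    {n : Fin 3 → ℕ} (hn : ∀ i, s i = true → n i ≠ 0) : ∃ x ∈ box L₁ L₂, mode L₁ L₂ s n x ≠ 0 := by
  refine ⟨fun i => side L₁ L₂ i / (2 * (n i + 1)), fun i => ⟨?_, ?_⟩, ?_⟩
  · have := side_pos hL₁ hL₂ i
    positivity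
  · have := side_pos hL₁ hL₂ i
    rw [div_lt_iff₀ (by positivity)]
    nlinarith [(n i).cast_nonneg (α := ℝ)]
  · rw [mode, prodFn, Finset.prod_ne_zero_iff]
    intro i _
    have hL := side_pos hL₁ hL₂ i
    have e : freq L₁ L₂ n i * (side L₁ L₂ i / (2 * (n i + 1))) = n i / (n i + 1) * (Real.pi / 2) := by
      rw [freq]; field_simp
    have h0 : (0 : ℝ) ≤ n i / (n i + 1) := by positivity
    have h1 : (n i : ℝ) / (n i + 1) < 1 := by rw [div_lt_one (by positivity)]; linarith
    have hpi := Real.pi_pos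
    rcases hs : s i
    · rw [trig_false]
      simp only [e]
      exact (Real.cos_pos_of_mem_Ioo ⟨by nlinarith, by nlinarith⟩).ne'
    · have h0 : (0 : ℝ) < n i / (n i + 1) := by
        have : (0 : ℝ) < n i := by exact_mod_cast Nat.pos_of_ne_zero (hn i hs)
        positivity
      rw [trig_true]
      simp only [e]
      exact (Real.sin_pos_of_pos_of_lt_pi (by positivity) (by nlinarith)).ne'

theorem eq_zero_of_ae_mode {L₁ L₂ : ℝ} {s : Fin 3 → Bool} {n : Fin 3 → ℕ} {x : Fin 3 → ℝ}
    (hx : x ∈ box L₁ L₂) (hx0 : mode L₁ L₂ s n x ≠ 0) {c : ℂ}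
    (h : ∀ᵐ y ∂(volume.restrict (box L₁ L₂)), c * (mode L₁ L₂ s n y : ℂ) = 0) : c = 0 := by
  have := Measure.eqOn_open_of_ae_eq (f := fun y => c * (mode L₁ L₂ s n y : ℂ)) (g := fun _ => 0) h
    (isOpen_box L₁ L₂) (continuous_const_mul c (contDiff_mode _ _ _ _)).continuousOn
    continuousOn_const hx
  simpa [hx0] using this

theorem sign_mul_self_mul_sign (r : ℝ) : (Real.sign r : ℂ) * r * Real.sign r = r := by
  have : Real.sign r * r * Real.sign r = r := by
    rcases lt_trichotomy r 0 with h | h | h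
    · simp [Real.sign_of_neg h]
    · simp [h]
    · simp [Real.sign_of_pos h]
  exact_mod_cast this

/-- A zero of the cubic is an eigenvalue. -/
theorem isEigenvalue_of_cubic {Pr Le L₁ L₂ R Rt : ℝ} (hPr : 0 < Pr) (hL₁ : 0 < L₁) (hL₂ : 0 < L₂)
    {j k : ℕ} (hjk : j ≠ 0 ∨ k ≠ 0) {β : ℂ} (hβ : cubic Pr Le L₁ L₂ R Rt j k 1 β = 0) :
    IsEigenvalue Pr Le L₁ L₂ R Rt β := by
  set g : ℂ := (gammaSq L₁ L₂ j k 1 : ℂ) with hg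
  set a : ℂ := (alphaSq L₁ L₂ j k : ℂ) with ha
  set n : Fin 3 → ℕ := ![j, k, 1] with hn
  have ha0 : a ≠ 0 := by
    rw [ha]; exact_mod_cast (alphaSq_pos hL₁ hL₂ hjk).ne'
  -- a kernel vector of the matrix of the system for the amplitudes of `u₃`, `T`, `S`
  obtain ⟨U, Θ, Ψ, hne, h1, h2, h3⟩ : ∃ U Θ Ψ : ℂ, ¬(U = 0 ∧ Θ = 0 ∧ Ψ = 0) ∧
      -(Pr * g + β) * g * U + Pr * a * (R * Θ - (Real.sign Rt * Rt) * Ψ) = 0 ∧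
      -g * Θ + U = β * Θ ∧ -(Le * g) * Ψ + Real.sign Rt * U = β * Ψ := by
    have hs := sign_mul_self_mul_sign Rt
    have hdet : (!![-(Pr * g + β) * g, Pr * a * R, -(Pr * a * (Real.sign Rt * Rt));
        1, -(g + β), 0; (Real.sign Rt : ℂ), 0, -(Le * g + β)] : Matrix (Fin 3) (Fin 3) ℂ).det
        = 0 := by
      rw [Matrix.det_fin_three]
      simp
      simp only [cubic] at hβ
      linear_combination -hβ - Pr * a * (g + β) * hs
    obtain ⟨v, hv, hmv⟩ := Matrix.exists_mulVec_eq_zero_iff.2 hdet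
    refine ⟨v 0, v 1, v 2, fun h => hv ?_, ?_, ?_, ?_⟩
    · ext i; fin_cases i <;> simp [h]
    · have := congrFun hmv 0
      simp [Matrix.mulVec, dotProduct, Fin.sum_univ_three] at this
      linear_combination this
    · have := congrFun hmv 1
      simp [Matrix.mulVec, dotProduct, Fin.sum_univ_three] at this
      linear_combination this
    · have := congrFun hmv 2
      simp [Matrix.mulVec, dotProduct, Fin.sum_univ_three] at this
      linear_combination this
  set w : Fin 3 → ℂ := fun i => (freq L₁ L₂ n i : ℂ) with hw
  have hw2 : w 2 = Real.pi := by simp [hw, hn, freq, side]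
  have haw : a = w 0 ^ 2 + w 1 ^ 2 := by
    have := alphaSq_eq L₁ L₂ n
    simp only [hn, Matrix.cons_val_zero, Matrix.cons_val_one] at this
    rw [ha, this]; push_cast; rfl
  have hgw : g = a + w 2 ^ 2 := by
    rw [hg, ha, gammaSq, hw2]; push_cast; ring
  -- The horizontal velocity is `α⁻²` times the horizontal gradient of `∂₃u₃`, which makes `u`
  -- divergence-free; the amplitude of the pressure then comes from the horizontal momentum equation.
  set V : Fin 3 → ℂ := ![-(w 0 * w 2 / a) * U, -(w 1 * w 2 / a) * U, U] with hV
  set P : ℂ := -(Pr * g + β) / Pr * (w 2 / a) * U with hP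
  refine ⟨fun i => modeH2 hL₁ hL₂ (V i) (velType i) n, modeH2 hL₁ hL₂ Θ (velType 2) n,
    modeH2 hL₁ hL₂ Ψ (velType 2) n,
    smoothH1 hL₁ hL₂ P (mode L₁ L₂ (fun _ => false) n) (contDiff_mode _ _ _ _), ?_, ?_, ?_⟩
  · intro h
    obtain ⟨x, hx, hx0⟩ := exists_mode_ne_zero hL₁ hL₂ (s := velType 2) (n := n)
      (by intro i hi; simp only [velType, decide_eq_true_eq] at hi; subst hi; simp [hn])
    refine hne ⟨?_, ?_, ?_⟩
    · exact eq_zero_of_ae_mode hx hx0 (h.mono fun y hy => hy.1 2)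
    · exact eq_zero_of_ae_mode hx hx0 (h.mono fun y hy => hy.2.1)
    · exact eq_zero_of_ae_mode hx hx0 (h.mono fun y hy => hy.2.2)
  · constructor
    · exact fun i => modeH2_dirichlet hL₁ hL₂ _ n (by simp [velType])
    · exact fun i m hm => modeH2_neumann hL₁ hL₂ _ n (by simp [velType, hm.symm])
    · exact ⟨modeH2_neumann hL₁ hL₂ _ n (by decide), modeH2_neumann hL₁ hL₂ _ n (by decide)⟩
    · exact ⟨modeH2_neumann hL₁ hL₂ _ n (by decide), modeH2_neumann hL₁ hL₂ _ n (by decide)⟩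
    · exact modeH2_dirichlet hL₁ hL₂ _ n (by decide)
    · exact modeH2_dirichlet hL₁ hL₂ _ n (by decide)
  · have hlap : ∀ c s x, (modeH2 hL₁ hL₂ c s n).lap x = -g * (c * mode L₁ L₂ s n x) :=
      fun c s x => modeH2_lap hL₁ hL₂ c s n x
    have hval : ∀ c s x, (modeH2 hL₁ hL₂ c s n).val x = c * mode L₁ L₂ s n x := fun _ _ _ => rfl
    have hu : ∀ i, Function.update (fun _ => false) i (!false) = velType i := by decide
    have hu' : ∀ i, Function.update (velType i) i (!true) = fun _ => false := by decide
    constructor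
    · intro i
      refine Filter.Eventually.of_forall fun x => ?_
      simp only [hlap, hval, smoothH1, pderiv_mode, hu]
      simp only [Bool.false_eq_true, if_false]
      push_cast
      rw [show (freq L₁ L₂ n i : ℂ) = w i from rfl]
      have hPr' : (Pr : ℂ) ≠ 0 := by exact_mod_cast hPr.ne'
      have hPP : Pr * P = -(Pr * g + β) * (w 2 / a) * U := by rw [hP]; field_simp
      fin_cases i
      · simp [hV]
        linear_combination (w 0 * (mode L₁ L₂ (velType 0) n x : ℂ)) * hPP
      · simp [hV]
        linear_combination (w 1 * (mode L₁ L₂ (velType 1) n x : ℂ)) * hPP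
      · have h1' : -(Pr * g + β) * (1 + w 2 ^ 2 / a) * U
            + Pr * (R * Θ - (Real.sign Rt * Rt) * Ψ) = 0 := by
          field_simp
          linear_combination h1 + (Pr * g + β) * U * hgw
        simp [hV]
        linear_combination (w 2 * (mode L₁ L₂ (velType 2) n x : ℂ)) * hPP
          + (mode L₁ L₂ (velType 2) n x : ℂ) * h1'
    · refine Filter.Eventually.of_forall fun x => ?_
      simp only [hlap, hval, hV]
      simp
      linear_combination (mode L₁ L₂ (velType 2) n x : ℂ) * h2
    · refine Filter.Eventually.of_forall fun x => ?_
      simp only [hlap, hval, hV]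
      simp
      linear_combination (mode L₁ L₂ (velType 2) n x : ℂ) * h3
    · refine Filter.Eventually.of_forall fun x => ?_
      have : ∀ i, (modeH2 hL₁ hL₂ (V i) (velType i) n).grad i x
          = V i * (w i * mode L₁ L₂ (fun _ => false) n x) := by
        intro i
        simp only [modeH2, smoothH2, smoothH1, pderiv_mode]
        rw [show velType i i = true by simp [velType], hu']
        simp [hw]
      rw [Finset.sum_congr rfl fun i _ => this i, Fin.sum_univ_three]
      simp [hV]
      field_simp
      rw [haw]
      ring

/-! ### Weak derivatives tested against modes -/

theorem abs_mul_deriv_smoothTransition_le :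
    ∃ C, ∀ z : ℝ, |z * deriv Real.smoothTransition (z - 1)| ≤ C := by
  have hc : Continuous (deriv Real.smoothTransition) :=
    (Real.smoothTransition.contDiff (n := 1)).continuous_deriv le_rfl
  obtain ⟨C, hC⟩ := (isCompact_Icc (a := (1 : ℝ)) (b := 2)).exists_bound_of_continuousOn
    (f := fun z => z * deriv Real.smoothTransition (z - 1))
    (by fun_prop)
  refine ⟨max C 0, fun z => ?_⟩
  by_cases hz : z ∈ Set.Icc (1 : ℝ) 2
  · exact (hC z hz).trans (le_max_left _ _)
  · have : deriv Real.smoothTransition (z - 1) = 0 := by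
      rw [Set.mem_Icc, not_and_or, not_le, not_le] at hz
      rcases hz with hz | hz
      · have : Real.smoothTransition =ᶠ[nhds (z - 1)] fun _ => 0 := by
          filter_upwards [Iio_mem_nhds (show z - 1 < 0 by linarith)] with y hy
          exact Real.smoothTransition.zero_of_nonpos (le_of_lt hy)
        rw [this.deriv_eq]; simp
      · have : Real.smoothTransition =ᶠ[nhds (z - 1)] fun _ => 1 := by
          filter_upwards [Ioi_mem_nhds (show 1 < z - 1 by linarith)] with y hy
          exact Real.smoothTransition.one_of_one_le (le_of_lt hy)
        rw [this.deriv_eq]; simp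
    simp [this]

/-- Cutoff functions on `(0, L)`. Their derivatives blow up at the end points, but not faster than
the reciprocal of the distance. -/
theorem exists_cutoff {L : ℝ} (hL : 0 < L) : ∃ χ : ℕ → ℝ → ℝ, (∀ N, ContDiff ℝ ∞ (χ N)) ∧
    (∀ N, tsupport (χ N) ⊆ Set.Ioo 0 L) ∧ (∀ N y, |χ N y| ≤ 1) ∧
    (∀ y ∈ Set.Ioo 0 L, ∀ᶠ N in Filter.atTop, χ N =ᶠ[nhds y] fun _ => 1) ∧
    ∃ C, ∀ N, ∀ y ∈ Set.Ioo 0 L, |y * (L - y) * deriv (χ N) y| ≤ C := by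
  obtain ⟨C, hC⟩ := abs_mul_deriv_smoothTransition_le
  refine ⟨fun N y => Real.smoothTransition (N * (y * (L - y)) - 1), fun N => ?_, fun N => ?_,
    fun N y => ?_, fun y hy => ?_, C * L, fun N y hy => ?_⟩
  · exact Real.smoothTransition.contDiff.comp (by fun_prop)
  · have hcl : IsClosed {y : ℝ | 1 ≤ N * (y * (L - y))} :=
      isClosed_le continuous_const (by fun_prop)
    refine (closure_minimal (fun y hy => ?_) hcl).trans fun y hy => ?_
    · by_contra hlt
      simp only [Set.mem_ofPred_eq, not_le] at hlt
      exact hy (Real.smoothTransition.zero_of_nonpos (by linarith))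
    · have hpos : 0 < y * (L - y) :=
        pos_of_mul_pos_right (lt_of_lt_of_le one_pos hy) N.cast_nonneg
      rcases pos_and_pos_or_neg_and_neg_of_mul_pos hpos with h | h
      · exact ⟨h.1, by linarith [h.2]⟩
      · linarith [h.1, h.2]
  · rw [abs_of_nonneg (Real.smoothTransition.nonneg _)]
    exact Real.smoothTransition.le_one _
  · have hpos : 0 < y * (L - y) := mul_pos hy.1 (by linarith [hy.2])
    obtain ⟨N₀, hN₀⟩ := exists_nat_gt (2 / (y * (L - y)))
    filter_upwards [Filter.eventually_ge_atTop N₀] with N hN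
    have h2 : 2 < N * (y * (L - y)) := by
      rw [div_lt_iff₀ hpos] at hN₀
      exact hN₀.trans_le (by gcongr)
    have hcont : ContinuousAt (fun y => N * (y * (L - y))) y := by fun_prop
    filter_upwards [hcont.eventually (lt_mem_nhds h2)] with z hz
    exact Real.smoothTransition.one_of_one_le (by linarith)
  · have hd : HasDerivAt (fun y => Real.smoothTransition (N * (y * (L - y)) - 1))
        (deriv Real.smoothTransition (N * (y * (L - y)) - 1) * (N * (1 * (L - y) + y * (-1)))) y := by
      refine HasDerivAt.comp y ((Real.smoothTransition.contDiff (n := 1)).differentiable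
        (by simp)).differentiableAt.hasDerivAt ?_
      exact ((((hasDerivAt_id y).mul ((hasDerivAt_id y).const_sub L)).const_mul _).sub_const _)
    rw [hd.deriv]
    have e : y * (L - y) * (deriv Real.smoothTransition (N * (y * (L - y)) - 1) *
        (N * (1 * (L - y) + y * (-1)))) = (N * (y * (L - y)) *
        deriv Real.smoothTransition (N * (y * (L - y)) - 1)) * (L - 2 * y) := by ring
    rw [e, abs_mul]
    have h1 := hC (N * (y * (L - y)))
    have h2 : |L - 2 * y| ≤ L := by rw [abs_le]; constructor <;> linarith [hy.1, hy.2]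
    exact mul_le_mul h1 h2 (abs_nonneg _) ((abs_nonneg _).trans h1)

theorem abs_prodFn_le {f : Fin 3 → ℝ → ℝ} {D : Fin 3 → ℝ} {x : Fin 3 → ℝ}
    (h : ∀ m, |f m (x m)| ≤ D m) : |prodFn f x| ≤ ∏ m, D m := by
  rw [prodFn, Finset.abs_prod]
  exact Finset.prod_le_prod (fun _ _ => abs_nonneg _) fun m _ => h m

theorem tendsto_integral_mul_prodFn {L₁ L₂ : ℝ} {f : (Fin 3 → ℝ) → ℂ}
    (hf : IntegrableOn f (box L₁ L₂)) {u : ℕ → Fin 3 → ℝ → ℝ} {v : Fin 3 → ℝ → ℝ}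
    (hu : ∀ N m, Continuous (u N m)) {D : Fin 3 → ℝ}
    (hD : ∀ N m, ∀ y ∈ Set.Ioo 0 (side L₁ L₂ m), |u N m y| ≤ D m)
    (hlim : ∀ m, ∀ y ∈ Set.Ioo 0 (side L₁ L₂ m), ∀ᶠ N in Filter.atTop, u N m y = v m y) :
    Filter.Tendsto (fun N => ∫ x in box L₁ L₂, f x * (prodFn (u N) x : ℂ)) Filter.atTop
      (nhds (∫ x in box L₁ L₂, f x * (prodFn v x : ℂ))) := by
  refine tendsto_integral_of_dominated_convergence (fun x => ‖f x‖ * ∏ m, D m) (fun N => ?_)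
    (hf.norm.mul_const _) (fun N => ?_) ?_
  · refine hf.aestronglyMeasurable.mul (Continuous.aestronglyMeasurable ?_)
    have : Continuous (prodFn (u N)) :=
      continuous_finsetProd _ fun m _ => (hu N m).comp (continuous_apply m)
    fun_prop
  · filter_upwards [ae_restrict_mem (measurableSet_box L₁ L₂)] with x hx
    rw [norm_mul, Complex.norm_real]
    exact mul_le_mul_of_nonneg_left (abs_prodFn_le fun m => hD N m _ (hx m)) (norm_nonneg _)
  · filter_upwards [ae_restrict_mem (measurableSet_box L₁ L₂)] with x hx
    refine tendsto_nhds_of_eventually_eq ?_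
    filter_upwards [Filter.eventually_all.2 fun m => hlim m _ (hx m)] with N hN
    simp [prodFn, hN]

/-- The test functions of a weak derivative in the direction `i` need not have compact support:
it is enough that they vanish on the two faces orthogonal to that direction. -/
theorem HasWeakPartial.integral_prodFn {L₁ L₂ : ℝ} (hL₁ : 0 < L₁) (hL₂ : 0 < L₂) {i : Fin 3}
    {f g : (Fin 3 → ℝ) → ℂ} (h : HasWeakPartial (box L₁ L₂) i f g)
    (hf : IntegrableOn f (box L₁ L₂)) (hg : IntegrableOn g (box L₁ L₂)) {t : Fin 3 → ℝ → ℝ}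
    (ht : ∀ m, ContDiff ℝ ∞ (t m)) {C : ℝ}
    (hC : ∀ y ∈ Set.Ioo 0 (side L₁ L₂ i), |t i y| ≤ C * (y * (side L₁ L₂ i - y))) :
    ∫ x in box L₁ L₂, f x * (pderiv i (prodFn t) x : ℂ)
      = -∫ x in box L₁ L₂, g x * (prodFn t x : ℂ) := by
  choose χ hχ hsupp hle hone C' hC' using fun m => exists_cutoff (side_pos hL₁ hL₂ m)
  choose B hB using fun m => (isCompact_Icc (a := 0) (b := side L₁ L₂ m)).exists_bound_of_continuousOn
    (ht m).continuous.continuousOn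
  choose B' hB' using fun m => (isCompact_Icc (a := 0)
    (b := side L₁ L₂ m)).exists_bound_of_continuousOn
    ((ht m).continuous_deriv (by simp)).continuousOn
  set u : ℕ → Fin 3 → ℝ → ℝ := fun N m y => t m y * χ m N y with hu
  have husm : ∀ N m, ContDiff ℝ ∞ (u N m) := fun N m => (ht m).mul (hχ m N)
  have hbound : ∀ N m, ∀ y ∈ Set.Ioo 0 (side L₁ L₂ m), |u N m y| ≤ B m := by
    intro N m y hy
    rw [hu, abs_mul]
    have := hB m y (Set.Ioo_subset_Icc_self hy)
    rw [Real.norm_eq_abs] at this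
    exact (mul_le_of_le_one_right (abs_nonneg _) (hle m N y)).trans this
  have hev : ∀ m, ∀ y ∈ Set.Ioo 0 (side L₁ L₂ m), ∀ᶠ N in Filter.atTop,
      u N m =ᶠ[nhds y] t m := by
    intro m y hy
    filter_upwards [hone m y hy] with N hN
    filter_upwards [hN] with z hz
    simp [hu, hz]
  have hderiv : ∀ N, ∀ y ∈ Set.Ioo 0 (side L₁ L₂ i), |deriv (u N i) y| ≤ B' i + C * C' i := by
    intro N y hy
    have e : deriv (u N i) y = deriv (t i) y * χ i N y + t i y * deriv (χ i N) y :=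
      deriv_mul ((ht i).differentiable (by simp)).differentiableAt
        ((hχ i N).differentiable (by simp)).differentiableAt
    have hw : 0 < y * (side L₁ L₂ i - y) := mul_pos hy.1 (by linarith [hy.2])
    have hC0 : 0 ≤ C := nonneg_of_mul_nonneg_left ((abs_nonneg _).trans (hC y hy)) hw
    rw [e]
    refine (abs_add_le _ _).trans (add_le_add ?_ ?_)
    · rw [abs_mul]
      have := hB' i y (Set.Ioo_subset_Icc_self hy)
      rw [Real.norm_eq_abs] at this
      exact (mul_le_of_le_one_right (abs_nonneg _) (hle i N y)).trans this
    · calc |t i y * deriv (χ i N) y| = |t i y| * |deriv (χ i N) y| := abs_mul _ _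
        _ ≤ C * (y * (side L₁ L₂ i - y)) * |deriv (χ i N) y| := by gcongr; exact hC y hy
        _ = C * |y * (side L₁ L₂ i - y) * deriv (χ i N) y| := by
          rw [abs_mul, abs_of_pos hw]; ring
        _ ≤ C * C' i := by gcongr; exact hC' i N y hy
  -- The derivative in the direction `i` stays bounded because `t i` compensates the blow-up of
  -- the derivative of the cutoff; all limits are by dominated convergence.
  have hlim₁ := tendsto_integral_mul_prodFn hg (fun N m => (husm N m).continuous) hbound
    fun m y hy => (hev m y hy).mono fun N hN => hN.eq_of_nhds
  have hlim₂ : Filter.Tendsto (fun N => ∫ x in box L₁ L₂, f x * (pderiv i (prodFn (u N)) x : ℂ))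
      Filter.atTop (nhds (∫ x in box L₁ L₂, f x * (pderiv i (prodFn t) x : ℂ))) := by
    rw [pderiv_prodFn ht]
    simp only [pderiv_prodFn (husm _)]
    refine tendsto_integral_mul_prodFn hf (D := Function.update B i (B' i + C * C' i))
      (fun N m => ?_) (fun N m y hy => ?_) fun m y hy => ?_
    · by_cases hm : m = i
      · subst hm
        simpa using (husm N m).continuous_deriv (by simp)
      · simpa [hm] using (husm N m).continuous
    · by_cases hm : m = i
      · subst hm
        simpa using hderiv N y hy
      · simpa [hm] using hbound N m y hy
    · by_cases hm : m = i
      · subst hm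
        filter_upwards [hev m y hy] with N hN
        simpa using hN.deriv_eq
      · filter_upwards [hev m y hy] with N hN
        simpa [hm] using hN.eq_of_nhds
  refine tendsto_nhds_unique (hlim₂.congr fun N => ?_) hlim₁.neg
  have hsub : tsupport (prodFn (u N)) ⊆ Set.univ.pi fun m => tsupport (χ m N) := by
    refine closure_minimal (fun x hx m _ => subset_tsupport _ fun h0 => hx ?_)
      (isClosed_set_pi fun m _ => isClosed_tsupport _)
    exact Finset.prod_eq_zero (Finset.mem_univ m) (by simp [hu, h0])
  refine h _ (contDiff_prodFn (husm N)) ?_ fun x hx m => hsupp m N (hsub hx m trivial)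
  refine (isCompact_univ_pi fun m => ?_).of_isClosed_subset (isClosed_tsupport _) hsub
  exact isCompact_Icc.of_isClosed_subset (isClosed_tsupport _)
    ((hsupp m N).trans Set.Ioo_subset_Icc_self)

theorem abs_sin_le_mul (n : ℕ) {L y : ℝ} (hy : y ∈ Set.Ioo 0 L) :
    |Real.sin (n * Real.pi / L * y)| ≤ 2 * n * Real.pi / L ^ 2 * (y * (L - y)) := by
  have hL : 0 < L := hy.1.trans hy.2
  have hy0 := hy.1
  have hyL := sub_pos.2 hy.2
  have key : ∀ z, 0 < z → 0 < L - z → z ≤ L / 2 →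
      |Real.sin (n * Real.pi / L * z)| ≤ 2 * n * Real.pi / L ^ 2 * (z * (L - z)) := by
    intro z hz hz' hzL
    refine Real.abs_sin_le_abs.trans ?_
    rw [abs_of_nonneg (by positivity)]
    have e : 2 * n * Real.pi / L ^ 2 * (z * (L - z))
        = n * Real.pi / L * z * (2 * (L - z) / L) := by field_simp
    rw [e]
    refine le_mul_of_one_le_right (by positivity) ?_
    rw [le_div_iff₀ hL]; linarith
  rcases le_total y (L / 2) with h | h
  · exact key y hy0 hyL h
  · have := key (L - y) hyL (by linarith) (by linarith)
    have e : n * Real.pi / L * (L - y) = n * Real.pi - n * Real.pi / L * y := by field_simp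
    rw [e, Real.sin_nat_mul_pi_sub, abs_neg, abs_mul, abs_pow, abs_neg, abs_one, one_pow,
      one_mul] at this
    calc _ ≤ _ := this
      _ = _ := by ring

theorem HasWeakPartial.integral_mode {L₁ L₂ : ℝ} (hL₁ : 0 < L₁) (hL₂ : 0 < L₂) {i : Fin 3}
    {f g : (Fin 3 → ℝ) → ℂ} (h : HasWeakPartial (box L₁ L₂) i f g)
    (hf : IntegrableOn f (box L₁ L₂)) (hg : IntegrableOn g (box L₁ L₂)) {s : Fin 3 → Bool}
    (hs : s i = true) (n : Fin 3 → ℕ) :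
    ∫ x in box L₁ L₂, f x * (pderiv i (mode L₁ L₂ s n) x : ℂ)
      = -∫ x in box L₁ L₂, g x * (mode L₁ L₂ s n x : ℂ) := by
  refine h.integral_prodFn hL₁ hL₂ hf hg (fun m => contDiff_trig _ _)
    (C := 2 * n i * Real.pi / side L₁ L₂ i ^ 2) fun y hy => ?_
  rw [hs, trig_true]
  exact abs_sin_le_mul (n i) hy

/-! ### Completeness of the modes -/

theorem exists_cos_mul_trig (s : Bool) (n : ℕ) : ∃ (n' : ℕ) (c : ℝ), ∀ a y : ℝ,
    Real.cos (a * y) * trig s (n * a) y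
      = 1 / 2 * trig s ((n + 1 : ℕ) * a) y + c * trig s (n' * a) y := by
  rcases n with _ | n
  · cases s
    · refine ⟨1, 1 / 2, fun a y => ?_⟩
      simp [trig_false]; ring
    · refine ⟨1, -1 / 2, fun a y => ?_⟩
      simp [trig_true]; ring
  · have e1 : ∀ a y : ℝ, ((n + 1 + 1 : ℕ) : ℝ) * a * y = (n + 1 : ℕ) * a * y + a * y := by
      intro a y; push_cast; ring
    have e2 : ∀ a y : ℝ, (n : ℝ) * a * y = (n + 1 : ℕ) * a * y - a * y := by
      intro a y; push_cast; ring
    refine ⟨n, 1 / 2, fun a y => ?_⟩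
    cases s
    · simp only [trig_false, e1, e2, Real.cos_add, Real.cos_sub]; ring
    · simp only [trig_true, e1, e2, Real.sin_add, Real.sin_sub]; ring

theorem exists_cos_mul_mode (L₁ L₂ : ℝ) (s : Fin 3 → Bool) (n : Fin 3 → ℕ) (i : Fin 3) :
    ∃ (n₁ n₂ : Fin 3 → ℕ) (c : ℝ), ∀ x, Real.cos (Real.pi / side L₁ L₂ i * x i) * mode L₁ L₂ s n x
      = 1 / 2 * mode L₁ L₂ s n₁ x + c * mode L₁ L₂ s n₂ x := by
  obtain ⟨n', c, h⟩ := exists_cos_mul_trig (s i) (n i)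
  refine ⟨Function.update n i (n i + 1), Function.update n i n', c, fun x => ?_⟩
  have hm : ∀ n : Fin 3 → ℕ, mode L₁ L₂ s n x
      = trig (s i) (n i * (Real.pi / side L₁ L₂ i)) (x i) *
        ∏ m ∈ Finset.univ.erase i, trig (s m) (freq L₁ L₂ n m) (x m) := by
    intro n
    rw [mode, prodFn, ← Finset.mul_prod_erase _ _ (Finset.mem_univ i), freq, mul_div_assoc]
  have he : ∀ k : ℕ, ∏ m ∈ Finset.univ.erase i, trig (s m) (freq L₁ L₂ (Function.update n i k) m) (x m)
      = ∏ m ∈ Finset.univ.erase i, trig (s m) (freq L₁ L₂ n m) (x m) := by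
    intro k
    refine Finset.prod_congr rfl fun m hm => ?_
    rw [freq, freq, Function.update_of_ne (Finset.ne_of_mem_erase hm)]
  rw [hm, hm, hm, he, he, Function.update_self, Function.update_self, ← mul_assoc, h]
  ring

/-- The lowest mode of the type `s` has no zeros in the box. -/
theorem mode_lowest_pos {L₁ L₂ : ℝ} (s : Fin 3 → Bool)
    {x : Fin 3 → ℝ} (hx : x ∈ box L₁ L₂) :
    0 < mode L₁ L₂ s (fun m => if s m then 1 else 0) x := by
  rw [mode, prodFn]
  refine Finset.prod_pos fun m _ => ?_
  have hL : 0 < side L₁ L₂ m := (hx m).1.trans (hx m).2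
  have hpi := Real.pi_pos
  have h0 := (hx m).1
  cases hs : s m
  · simp [trig_false, freq, hs]
  · simp only [trig_true, freq, hs]
    refine Real.sin_pos_of_pos_of_lt_pi (by simp; positivity) ?_
    simp only [if_true, Nat.cast_one, one_mul]
    rw [div_mul_eq_mul_div, div_lt_iff₀ hL]
    exact mul_lt_mul_of_pos_left (hx m).2 hpi

/-- The function `φ` times any mode of the type `s` is orthogonal to `f` in the box. -/
def OrthModes (L₁ L₂ : ℝ) (s : Fin 3 → Bool) (f : (Fin 3 → ℝ) → ℂ) (φ : (Fin 3 → ℝ) → ℝ) : Prop :=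
  Continuous φ ∧ ∀ n, ∫ x in box L₁ L₂, f x * ((φ x * mode L₁ L₂ s n x : ℝ) : ℂ) = 0

theorem integrableOn_mul_ofReal {L₁ L₂ : ℝ} {f : (Fin 3 → ℝ) → ℂ} (hf : IntegrableOn f (box L₁ L₂))
    {φ : (Fin 3 → ℝ) → ℝ} (hφ : Continuous φ) :
    IntegrableOn (fun x => f x * (φ x : ℂ)) (box L₁ L₂) := by
  obtain ⟨C, hC⟩ := (isCompact_Icc (a := (0 : Fin 3 → ℝ)) (b := side L₁ L₂)).exists_bound_of_continuousOn
    hφ.continuousOn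
  refine Integrable.mul_bdd (c := C) hf (by fun_prop) ?_
  filter_upwards [ae_restrict_mem (measurableSet_box L₁ L₂)] with x hx
  rw [Complex.norm_real]
  exact hC x (box_subset_Icc _ _ hx)

namespace OrthModes

variable {L₁ L₂ : ℝ} {s : Fin 3 → Bool} {f : (Fin 3 → ℝ) → ℂ} {φ ψ : (Fin 3 → ℝ) → ℝ}

theorem integrableOn (hφ : OrthModes L₁ L₂ s f φ) (hf : IntegrableOn f (box L₁ L₂))
    (n : Fin 3 → ℕ) :
    IntegrableOn (fun x => f x * ((φ x * mode L₁ L₂ s n x : ℝ) : ℂ)) (box L₁ L₂) :=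
  integrableOn_mul_ofReal hf (hφ.1.mul (contDiff_mode L₁ L₂ s n).continuous)

theorem add (hf : IntegrableOn f (box L₁ L₂)) (hφ : OrthModes L₁ L₂ s f φ)
    (hψ : OrthModes L₁ L₂ s f ψ) : OrthModes L₁ L₂ s f (fun x => φ x + ψ x) := by
  refine ⟨hφ.1.add hψ.1, fun n => ?_⟩
  rw [← add_zero (0 : ℂ)]
  nth_rw 1 [← hφ.2 n]
  rw [← hψ.2 n, ← integral_add (hφ.integrableOn hf n) (hψ.integrableOn hf n)]
  refine integral_congr_ae (Filter.Eventually.of_forall fun x => ?_)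
  simp; ring

theorem const_mul (c : ℝ) (hφ : OrthModes L₁ L₂ s f φ) :
    OrthModes L₁ L₂ s f (fun x => c * φ x) := by
  refine ⟨continuous_const.mul hφ.1, fun n => ?_⟩
  rw [← mul_zero (c : ℂ), ← hφ.2 n, ← integral_const_mul]
  refine integral_congr_ae (Filter.Eventually.of_forall fun x => ?_)
  simp; ring

theorem cos_mul (hf : IntegrableOn f (box L₁ L₂)) (hφ : OrthModes L₁ L₂ s f φ) (i : Fin 3) :
    OrthModes L₁ L₂ s f (fun x => Real.cos (Real.pi / side L₁ L₂ i * x i) * φ x) := by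
  have hφc := hφ.1
  refine ⟨by fun_prop, fun n => ?_⟩
  obtain ⟨n₁, n₂, c, h⟩ := exists_cos_mul_mode L₁ L₂ s n i
  have e : ∀ x, f x * ((Real.cos (Real.pi / side L₁ L₂ i * x i) * φ x * mode L₁ L₂ s n x : ℝ) : ℂ)
      = (1 / 2 : ℝ) * (f x * ((φ x * mode L₁ L₂ s n₁ x : ℝ) : ℂ))
        + c * (f x * ((φ x * mode L₁ L₂ s n₂ x : ℝ) : ℂ)) := by
    intro x
    rw [mul_right_comm, h]
    push_cast
    ring
  simp only [e]
  rw [integral_add ((hφ.integrableOn hf n₁).const_mul _) ((hφ.integrableOn hf n₂).const_mul _),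
    integral_const_mul,
    integral_const_mul, hφ.2, hφ.2]
  simp

end OrthModes

/-- The cosine `cos (π xᵢ / Lᵢ)` on the closed box. -/
noncomputable def cosCoord (L₁ L₂ : ℝ) (i : Fin 3) : C(Set.Icc 0 (side L₁ L₂), ℝ) :=
  ⟨fun x => Real.cos (Real.pi / side L₁ L₂ i * x.1 i),
    Real.continuous_cos.comp (continuous_const.mul ((continuous_apply i).comp continuous_subtype_val))⟩

theorem adjoin_cosCoord_dense {L₁ L₂ : ℝ} (hL₁ : 0 < L₁) (hL₂ : 0 < L₂) :
    (Algebra.adjoin ℝ (Set.range (cosCoord L₁ L₂))).topologicalClosure = ⊤ := by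
  refine ContinuousMap.subalgebra_topologicalClosure_eq_top_of_separatesPoints _ fun x y hxy => ?_
  obtain ⟨i, hi⟩ : ∃ i, x.1 i ≠ y.1 i := by
    by_contra! h
    exact hxy (Subtype.ext (funext h))
  refine ⟨cosCoord L₁ L₂ i, ⟨_, Algebra.subset_adjoin ⟨i, rfl⟩, rfl⟩, fun h => hi ?_⟩
  have hL := side_pos hL₁ hL₂ i
  have hmem : ∀ z : Set.Icc 0 (side L₁ L₂), Real.pi / side L₁ L₂ i * z.1 i ∈ Set.Icc 0 Real.pi := by
    intro z
    have h1 : 0 ≤ z.1 i := z.2.1 i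
    have h2 := z.2.2 i
    refine ⟨by positivity, ?_⟩
    rw [div_mul_eq_mul_div, div_le_iff₀ hL]
    exact mul_le_mul_of_nonneg_left h2 Real.pi_pos.le
  have := Real.injOn_cos (hmem x) (hmem y) h
  exact mul_left_cancel₀ (by positivity) this

theorem exists_orthModes_of_mem_adjoin {L₁ L₂ : ℝ} {s : Fin 3 → Bool} {f : (Fin 3 → ℝ) → ℂ}
    (hf : IntegrableOn f (box L₁ L₂)) {p : C(Set.Icc 0 (side L₁ L₂), ℝ)}
    (hp : p ∈ Algebra.adjoin ℝ (Set.range (cosCoord L₁ L₂))) :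
    ∃ q : (Fin 3 → ℝ) → ℝ, (∀ x : Set.Icc 0 (side L₁ L₂), q x = p x) ∧
      ∀ φ, OrthModes L₁ L₂ s f φ → OrthModes L₁ L₂ s f (fun x => q x * φ x) := by
  induction hp using Algebra.adjoin_induction with
  | mem p hp =>
    obtain ⟨i, rfl⟩ := hp
    exact ⟨fun x => Real.cos (Real.pi / side L₁ L₂ i * x i), fun _ => rfl,
      fun φ hφ => hφ.cos_mul hf i⟩
  | algebraMap r => exact ⟨fun _ => r, fun _ => rfl, fun φ hφ => hφ.const_mul r⟩
  | add p₁ p₂ _ _ h₁ h₂ =>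
    obtain ⟨q₁, e₁, h₁⟩ := h₁
    obtain ⟨q₂, e₂, h₂⟩ := h₂
    refine ⟨fun x => q₁ x + q₂ x, fun x => by simp [e₁, e₂], fun φ hφ => ?_⟩
    simpa only [add_mul] using (h₁ φ hφ).add hf (h₂ φ hφ)
  | mul p₁ p₂ _ _ h₁ h₂ =>
    obtain ⟨q₁, e₁, h₁⟩ := h₁
    obtain ⟨q₂, e₂, h₂⟩ := h₂
    refine ⟨fun x => q₁ x * q₂ x, fun x => by simp [e₁, e₂], fun φ hφ => ?_⟩
    simpa only [mul_assoc] using h₁ _ (h₂ φ hφ)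

/-- Multiplication by the cosines of the coordinates preserves the span of the modes of one type.
By the Stone–Weierstrass theorem, a function orthogonal to all these modes is thus orthogonal to
the lowest of them times any continuous function. -/
theorem ae_eq_zero_of_integral_mode_eq_zero {L₁ L₂ : ℝ} (hL₁ : 0 < L₁) (hL₂ : 0 < L₂)
    {f : (Fin 3 → ℝ) → ℂ} (hf : IntegrableOn f (box L₁ L₂)) (s : Fin 3 → Bool)
    (h : ∀ n, ∫ x in box L₁ L₂, f x * (mode L₁ L₂ s n x : ℂ) = 0) :
    ∀ᵐ x ∂(volume.restrict (box L₁ L₂)), f x = 0 := by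
  set e : (Fin 3 → ℝ) → ℝ := mode L₁ L₂ s (fun m => if s m then 1 else 0) with he
  have hec : Continuous e := (contDiff_mode _ _ _ _).continuous
  have hfe : IntegrableOn (fun x => f x * (e x : ℂ)) (box L₁ L₂) := integrableOn_mul_ofReal hf hec
  have h1 : OrthModes L₁ L₂ s f (fun _ => 1) := ⟨continuous_const, fun n => by simpa using h n⟩
  have key : ∀ φ : (Fin 3 → ℝ) → ℝ, Continuous φ →
      ∫ x in box L₁ L₂, (f x * (e x : ℂ)) * (φ x : ℂ) = 0 := by
    intro φ hφ
    set M : ℝ := ∫ x in box L₁ L₂, ‖f x * (e x : ℂ)‖ with hM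
    have hM0 : 0 ≤ M := integral_nonneg fun _ => norm_nonneg _
    rw [← norm_le_zero_iff]
    refine le_of_forall_pos_le_add fun ε hε => ?_
    let φK : C(Set.Icc 0 (side L₁ L₂), ℝ) := ⟨fun x => φ x, by fun_prop⟩
    have hmem : φK ∈ closure ((Algebra.adjoin ℝ (Set.range (cosCoord L₁ L₂)) :
        Subalgebra ℝ C(Set.Icc 0 (side L₁ L₂), ℝ)) : Set C(Set.Icc 0 (side L₁ L₂), ℝ)) := by
      rw [← Subalgebra.topologicalClosure_coe, adjoin_cosCoord_dense hL₁ hL₂]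
      trivial
    obtain ⟨p, hp, hdist⟩ := Metric.mem_closure_iff.1 hmem (ε / (M + 1)) (by positivity)
    obtain ⟨q, hq, horth⟩ := exists_orthModes_of_mem_adjoin (s := s) hf hp
    have hq1 := horth _ h1
    simp only [mul_one] at hq1
    have hint : ∫ x in box L₁ L₂, (f x * (e x : ℂ)) * (q x : ℂ) = 0 := by
      rw [← hq1.2 (fun m => if s m then 1 else 0)]
      refine integral_congr_ae (Filter.Eventually.of_forall fun x => ?_)
      simp [he]; ring
    rw [zero_add, ← sub_zero (∫ x in box L₁ L₂, (f x * (e x : ℂ)) * (φ x : ℂ)), ← hint,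
      ← integral_sub (integrableOn_mul_ofReal hfe hφ) (integrableOn_mul_ofReal hfe hq1.1)]
    calc _ ≤ ∫ x in box L₁ L₂, ‖f x * (e x : ℂ)‖ * (ε / (M + 1)) := by
          refine norm_integral_le_of_norm_le (hfe.norm.mul_const _) ?_
          filter_upwards [ae_restrict_mem (measurableSet_box L₁ L₂)] with x hx
          rw [← mul_sub, norm_mul]
          refine mul_le_mul_of_nonneg_left ?_ (norm_nonneg _)
          have := (ContinuousMap.dist_apply_le_dist (f := φK) (g := p)
            ⟨x, box_subset_Icc _ _ hx⟩).trans hdist.le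
          rw [← hq, Real.dist_eq] at this
          rwa [← Complex.ofReal_sub, Complex.norm_real]
      _ = M * (ε / (M + 1)) := by rw [integral_mul_const]
      _ ≤ ε := by
          rw [mul_div_assoc', div_le_iff₀ (by positivity)]
          nlinarith
  have hz : ∀ᵐ x ∂volume, x ∈ box L₁ L₂ → f x * (e x : ℂ) = 0 := by
    refine (isOpen_box L₁ L₂).ae_eq_zero_of_integral_contDiff_smul_eq_zero
      hfe.locallyIntegrableOn fun g hg _ hsupp => ?_
    rw [← key g hg.continuous, ← setIntegral_eq_integral_of_forall_compl_eq_zero (s := box L₁ L₂)]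
    · refine integral_congr_ae (Filter.Eventually.of_forall fun x => ?_)
      simp; ring
    · intro x hx
      rw [image_eq_zero_of_notMem_tsupport fun h => hx (hsupp h), zero_smul]
  rw [ae_restrict_iff' (measurableSet_box L₁ L₂)]
  filter_upwards [hz] with x hx hxb
  have : (e x : ℂ) ≠ 0 := by exact_mod_cast (mode_lowest_pos s hxb).ne'
  exact (mul_eq_zero.1 (hx hxb)).resolve_right this

/-! ### Localization of the spectrum -/

theorem integrableOn_of_memLp {L₁ L₂ : ℝ} {f : (Fin 3 → ℝ) → ℂ}
    (hf : MemLp f 2 (volume.restrict (box L₁ L₂))) : IntegrableOn f (box L₁ L₂) := by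
  have : IsFiniteMeasure (volume.restrict (box L₁ L₂)) :=
    ⟨by
      rw [Measure.restrict_apply_univ]
      exact (measure_mono (box_subset_Icc L₁ L₂)).trans_lt isCompact_Icc.measure_lt_top⟩
  exact hf.integrable (by norm_num)

/-- The Fourier coefficient of `f` (up to normalization) for the mode `n` of the type `s`. -/
noncomputable def coeff (L₁ L₂ : ℝ) (f : (Fin 3 → ℝ) → ℂ) (s : Fin 3 → Bool) (n : Fin 3 → ℕ) : ℂ :=
  ∫ x in box L₁ L₂, f x * (mode L₁ L₂ s n x : ℂ)

section Coeff

variable {L₁ L₂ : ℝ} {f g : (Fin 3 → ℝ) → ℂ} {s : Fin 3 → Bool} {n : Fin 3 → ℕ}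

theorem integrableOn_mul_mode (hf : IntegrableOn f (box L₁ L₂)) (s : Fin 3 → Bool)
    (n : Fin 3 → ℕ) : IntegrableOn (fun x => f x * (mode L₁ L₂ s n x : ℂ)) (box L₁ L₂) :=
  integrableOn_mul_ofReal hf (contDiff_mode L₁ L₂ s n).continuous

theorem coeff_add (hf : IntegrableOn f (box L₁ L₂)) (hg : IntegrableOn g (box L₁ L₂)) :
    coeff L₁ L₂ (fun x => f x + g x) s n = coeff L₁ L₂ f s n + coeff L₁ L₂ g s n := by
  simp only [coeff, add_mul]
  exact integral_add (integrableOn_mul_mode hf s n) (integrableOn_mul_mode hg s n)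

theorem coeff_sub (hf : IntegrableOn f (box L₁ L₂)) (hg : IntegrableOn g (box L₁ L₂)) :
    coeff L₁ L₂ (fun x => f x - g x) s n = coeff L₁ L₂ f s n - coeff L₁ L₂ g s n := by
  simp only [coeff, sub_mul]
  exact integral_sub (integrableOn_mul_mode hf s n) (integrableOn_mul_mode hg s n)

theorem coeff_const_mul (c : ℂ) :
    coeff L₁ L₂ (fun x => c * f x) s n = c * coeff L₁ L₂ f s n := by
  simp only [coeff, mul_assoc, integral_const_mul]

theorem coeff_congr (h : ∀ᵐ x ∂(volume.restrict (box L₁ L₂)), f x = g x) :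
    coeff L₁ L₂ f s n = coeff L₁ L₂ g s n :=
  integral_congr_ae (h.mono fun x hx => by simp only [hx])

theorem coeff_eq_zero {i : Fin 3} (hs : s i = true) (hn : n i = 0) : coeff L₁ L₂ f s n = 0 := by
  have : ∀ x, mode L₁ L₂ s n x = 0 := by
    intro x
    rw [mode, prodFn]
    exact Finset.prod_eq_zero (Finset.mem_univ i) (by simp [hs, trig_true, freq, hn])
  simp [coeff, this]

/-- A weak derivative in a direction in which the mode is a sine. -/
theorem coeff_weakPartial (hL₁ : 0 < L₁) (hL₂ : 0 < L₂) {i : Fin 3}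
    (h : HasWeakPartial (box L₁ L₂) i f g)
    (hf : IntegrableOn f (box L₁ L₂)) (hg : IntegrableOn g (box L₁ L₂)) (hs : s i = true) :
    coeff L₁ L₂ g s n = -(freq L₁ L₂ n i * coeff L₁ L₂ f (Function.update s i false) n) := by
  have := h.integral_mode hL₁ hL₂ hf hg hs n
  simp only [pderiv_mode, hs, if_true, Bool.not_true, Complex.ofReal_mul,
    mul_left_comm _ (freq L₁ L₂ n i : ℂ), integral_const_mul] at this
  rw [coeff, coeff]
  linear_combination this

/-- A weak derivative in a direction in which the mode is a cosine. -/
theorem coeff_vanishesOnFaces {i : Fin 3} (h : VanishesOnFaces (box L₁ L₂) i f g)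
    (hs : s i = false) :
    coeff L₁ L₂ g s n = freq L₁ L₂ n i * coeff L₁ L₂ f (Function.update s i true) n := by
  have := h (mode L₁ L₂ s n) (contDiff_mode _ _ _ _)
  simp only [pderiv_mode, hs, Bool.false_eq_true, if_false, Bool.not_false, Complex.ofReal_mul,
    Complex.ofReal_neg, mul_left_comm _ (-(freq L₁ L₂ n i : ℂ)), integral_const_mul] at this
  rw [coeff, coeff]
  linear_combination this

end Coeff

theorem SobolevH2.coeff_hess {L₁ L₂ : ℝ} (hL₁ : 0 < L₁) (hL₂ : 0 < L₂) (f : SobolevH2 (box L₁ L₂))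
    {s : Fin 3 → Bool} (n : Fin 3 → ℕ) {i : Fin 3} (hD : s i = true → f.Dirichlet i)
    (hN : s i = false → f.Neumann i) :
    coeff L₁ L₂ (f.hess i i) s n = -freq L₁ L₂ n i ^ 2 * coeff L₁ L₂ f.val s n := by
  have hv := integrableOn_of_memLp f.memLp_val
  have hg := integrableOn_of_memLp (f.memLp_grad i)
  have hh := integrableOn_of_memLp (f.memLp_hess i i)
  cases hs : s i
  · rw [coeff_vanishesOnFaces (hN hs) hs,
      coeff_weakPartial hL₁ hL₂ (f.weak_grad i) hv hg (Function.update_self i true s),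
      Function.update_idem, ← hs, Function.update_eq_self]
    ring
  · rw [coeff_weakPartial hL₁ hL₂ (f.weak_hess i i) hg hh hs,
      coeff_vanishesOnFaces (hD hs) (Function.update_self i false s),
      Function.update_idem, ← hs, Function.update_eq_self]
    ring

theorem SobolevH2.integrableOn_lap {L₁ L₂ : ℝ} (f : SobolevH2 (box L₁ L₂)) :
    IntegrableOn f.lap (box L₁ L₂) := by
  have : f.lap = fun x => ∑ i, f.hess i i x := rfl
  rw [this]
  exact integrable_finsetSum _ fun i _ => integrableOn_of_memLp (f.memLp_hess i i)

/-- The modes that satisfy the boundary conditions of `f` diagonalize the Laplacian. -/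
theorem SobolevH2.coeff_lap {L₁ L₂ : ℝ} (hL₁ : 0 < L₁) (hL₂ : 0 < L₂) (f : SobolevH2 (box L₁ L₂))
    {s : Fin 3 → Bool} (n : Fin 3 → ℕ) (hD : ∀ i, s i = true → f.Dirichlet i)
    (hN : ∀ i, s i = false → f.Neumann i) :
    coeff L₁ L₂ f.lap s n = -(gammaSq L₁ L₂ (n 0) (n 1) (n 2) : ℂ) * coeff L₁ L₂ f.val s n := by
  have hh := fun i => integrableOn_of_memLp (f.memLp_hess i i)
  have e : f.lap = fun x => (f.hess 0 0 x + f.hess 1 1 x) + f.hess 2 2 x := by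
    ext x; simp [SobolevH2.lap, Fin.sum_univ_three]
  have h01 : IntegrableOn (fun x => f.hess 0 0 x + f.hess 1 1 x) (box L₁ L₂) := (hh 0).add (hh 1)
  rw [e, coeff_add h01 (hh 2), coeff_add (hh 0) (hh 1), gammaSq_eq,
    Fin.sum_univ_three]
  simp only [f.coeff_hess hL₁ hL₂ n (hD _) (hN _)]
  push_cast
  ring

/-- For every triple `n`, the Fourier coefficients of a solution of the eigenvalue problem solve
the algebraic equations of the mode `n`. -/
theorem coeff_equations {Pr Le L₁ L₂ R Rt : ℝ} (hL₁ : 0 < L₁) (hL₂ : 0 < L₂) {β : ℂ}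
    {u : Fin 3 → SobolevH2 (box L₁ L₂)} {T S : SobolevH2 (box L₁ L₂)} {p : SobolevH1 (box L₁ L₂)}
    (hb : FreeBoundary u T S) (hs : SolvesEigenEquations Pr Le R Rt β u T S p) (n : Fin 3 → ℕ)
    {g : ℂ} (hg : g = (gammaSq L₁ L₂ (n 0) (n 1) (n 2) : ℂ))
    {U : Fin 3 → ℂ} (hU : ∀ i, U i = coeff L₁ L₂ (u i).val (velType i) n)
    {Θ : ℂ} (hΘ : Θ = coeff L₁ L₂ T.val (velType 2) n)
    {Ψ : ℂ} (hΨ : Ψ = coeff L₁ L₂ S.val (velType 2) n) :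
    (∃ P : ℂ, ∀ i, Pr * (-g * U i + freq L₁ L₂ n i * P)
      + (if i = 2 then Pr * (R * Θ - Real.sign Rt * Rt * Ψ) else 0) = β * U i) ∧
    -g * Θ + U 2 = β * Θ ∧ Le * (-g * Ψ) + Real.sign Rt * U 2 = β * Ψ ∧
    ∑ i, (freq L₁ L₂ n i : ℂ) * U i = 0 := by
  have hTi := integrableOn_of_memLp T.memLp_val
  have hSi := integrableOn_of_memLp S.memLp_val
  have hui := fun i => integrableOn_of_memLp (u i).memLp_val
  have hlT : coeff L₁ L₂ T.lap (velType 2) n = -g * Θ := by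
    rw [hg, hΘ]
    refine T.coeff_lap hL₁ hL₂ n (fun i hi => ?_) fun i hi => ?_
    · fin_cases i <;> simp [velType] at hi
      exact hb.T_vertical
    · fin_cases i <;> simp [velType] at hi
      exacts [hb.T_lateral.1, hb.T_lateral.2]
  have hlS : coeff L₁ L₂ S.lap (velType 2) n = -g * Ψ := by
    rw [hg, hΨ]
    refine S.coeff_lap hL₁ hL₂ n (fun i hi => ?_) fun i hi => ?_
    · fin_cases i <;> simp [velType] at hi
      exact hb.S_vertical
    · fin_cases i <;> simp [velType] at hi
      exacts [hb.S_lateral.1, hb.S_lateral.2]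
  have hlu : ∀ m, coeff L₁ L₂ (u m).lap (velType m) n = -g * U m := by
    intro m
    rw [hg, hU]
    refine (u m).coeff_lap hL₁ hL₂ n (fun i hi => ?_) fun i hi => ?_
    · simp only [velType, decide_eq_true_eq] at hi
      exact hi ▸ hb.u_normal i
    · simp only [velType, decide_eq_false_iff_not] at hi
      exact hb.u_tangential i m (Ne.symm hi)
  have hu' : ∀ i, Function.update (fun _ => false) i true = velType i := by decide
  have hu'' : ∀ i, Function.update (velType i) i false = fun _ => false := by decide
  refine ⟨⟨coeff L₁ L₂ p.val (fun _ => false) n, fun i => ?_⟩, ?_, ?_, ?_⟩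
  · have hpi := integrableOn_of_memLp (p.memLp_grad i)
    have hp : coeff L₁ L₂ (p.grad i) (velType i) n
        = -(freq L₁ L₂ n i * coeff L₁ L₂ p.val (fun _ => false) n) := by
      rw [coeff_weakPartial hL₁ hL₂ (p.weak_grad i) (integrableOn_of_memLp p.memLp_val) hpi
        (by simp [velType]), hu'']
    have hc := coeff_congr (s := velType i) (n := n) (hs.momentum i)
    have h1 : IntegrableOn (fun x => (Pr : ℂ) * ((u i).lap x - p.grad i x)) (box L₁ L₂) :=
      ((u i).integrableOn_lap.sub hpi).const_mul _
    rw [coeff_const_mul (f := (u i).val), ← hU] at hc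
    by_cases hi : i = 2
    · subst hi
      simp only [if_true] at hc ⊢
      have h2 : IntegrableOn (fun x => (Pr : ℂ) * (R * T.val x - Real.sign Rt * Rt * S.val x))
        (box L₁ L₂) := ((hTi.const_mul _).sub (hSi.const_mul _)).const_mul _
      rw [coeff_add h1 h2,
        coeff_const_mul, coeff_sub (u 2).integrableOn_lap hpi, coeff_const_mul,
        coeff_sub (hTi.const_mul _) (hSi.const_mul _), coeff_const_mul, coeff_const_mul, hlu, hp,
        ← hΘ, ← hΨ] at hc
      linear_combination hc
    · simp only [if_neg hi, add_zero] at hc ⊢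
      rw [coeff_const_mul, coeff_sub (u i).integrableOn_lap hpi, hlu, hp] at hc
      linear_combination hc
  · have hc := coeff_congr (s := velType 2) (n := n) hs.heat
    rwa [coeff_add T.integrableOn_lap (hui 2), coeff_const_mul, hlT, ← hU, ← hΘ] at hc
  · have hc := coeff_congr (s := velType 2) (n := n) hs.salt
    rwa [coeff_add (S.integrableOn_lap.const_mul _) ((hui 2).const_mul _), coeff_const_mul,
      coeff_const_mul, coeff_const_mul, hlS, ← hU, ← hΨ] at hc
  · have hi := fun i => integrableOn_of_memLp ((u i).memLp_grad i)
    have h01 : IntegrableOn (fun x => (u 0).grad 0 x + (u 1).grad 1 x) (box L₁ L₂) :=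
      (hi 0).add (hi 1)
    have hc : coeff L₁ L₂ (fun x => ((u 0).grad 0 x + (u 1).grad 1 x) + (u 2).grad 2 x)
        (fun _ => false) n = coeff L₁ L₂ (fun _ => 0) (fun _ => false) n :=
      coeff_congr (hs.div_free.mono fun x hx => by rwa [Fin.sum_univ_three] at hx)
    rw [coeff_add h01 (hi 2), coeff_add (hi 0) (hi 1)] at hc
    have hd : ∀ i, coeff L₁ L₂ ((u i).grad i) (fun _ => false) n = freq L₁ L₂ n i * U i := by
      intro i
      rw [coeff_vanishesOnFaces (hb.u_normal i) rfl, hu', hU]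
    rw [hd, hd, hd] at hc
    rw [Fin.sum_univ_three, hc]
    simp [coeff]

theorem add_ne_zero_of_not_neg {β : ℂ} (hβ : ¬(β.im = 0 ∧ β.re < 0)) {c : ℝ} (hc : 0 < c) :
    (c : ℂ) + β ≠ 0 := by
  intro h
  have hr := congrArg Complex.re h
  have hi := congrArg Complex.im h
  simp at hr hi
  exact hβ ⟨hi, by linarith⟩

theorem gammaSq_pos {L₁ L₂ : ℝ} (hL₁ : 0 < L₁) (hL₂ : 0 < L₂) {j k l : ℕ}
    (h : j ≠ 0 ∨ k ≠ 0 ∨ l ≠ 0) : 0 < gammaSq L₁ L₂ j k l := by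
  have hpi := Real.pi_pos
  rw [gammaSq, alphaSq]
  rcases h with h | h | h <;> positivity

/-- Every eigenvalue is real and negative, or a zero of the cubic of some mode. -/
theorem exists_cubic_eq_zero_of_isEigenvalue {Pr Le L₁ L₂ R Rt : ℝ} (hPr : 0 < Pr) (hLe : 0 < Le)
    (hL₁ : 0 < L₁) (hL₂ : 0 < L₂) {β : ℂ} (hE : IsEigenvalue Pr Le L₁ L₂ R Rt β)
    (hβ : ¬(β.im = 0 ∧ β.re < 0)) :
    ∃ j k l : ℕ, (j ≠ 0 ∨ k ≠ 0) ∧ l ≠ 0 ∧ cubic Pr Le L₁ L₂ R Rt j k l β = 0 := by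
  by_contra! hcub
  obtain ⟨u, T, S, p, hne, hb, hs⟩ := hE
  have key : ∀ n : Fin 3 → ℕ, (∀ i, coeff L₁ L₂ (u i).val (velType i) n = 0) ∧
      coeff L₁ L₂ T.val (velType 2) n = 0 ∧ coeff L₁ L₂ S.val (velType 2) n = 0 := by
    intro n
    set g : ℂ := (gammaSq L₁ L₂ (n 0) (n 1) (n 2) : ℂ) with hg
    set U : Fin 3 → ℂ := fun i => coeff L₁ L₂ (u i).val (velType i) n with hU
    set Θ : ℂ := coeff L₁ L₂ T.val (velType 2) n with hΘ
    set Ψ : ℂ := coeff L₁ L₂ S.val (velType 2) n with hΨ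
    obtain ⟨⟨P, hP⟩, hT, hS, hdiv⟩ :=
      coeff_equations hL₁ hL₂ hb hs n hg (fun i => rfl : ∀ i, U i = _) hΘ hΨ
    rcases eq_or_ne n 0 with rfl | hn
    · exact ⟨fun i => coeff_eq_zero (i := i) (by simp [velType]) rfl,
        coeff_eq_zero (i := 2) (by simp [velType]) rfl,
        coeff_eq_zero (i := 2) (by simp [velType]) rfl⟩
    have hpos : 0 < gammaSq L₁ L₂ (n 0) (n 1) (n 2) := by
      refine gammaSq_pos hL₁ hL₂ ?_
      by_contra! h
      exact hn (by ext i; fin_cases i; exacts [h.1, h.2.1, h.2.2])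
    have hg0 : g ≠ 0 := by rw [hg]; exact_mod_cast hpos.ne'
    have hn1 : g + β ≠ 0 := add_ne_zero_of_not_neg hβ hpos
    have hn2 : Le * g + β ≠ 0 := by
      have := add_ne_zero_of_not_neg hβ (mul_pos hLe hpos)
      rwa [Complex.ofReal_mul] at this
    have hn3 : Pr * g + β ≠ 0 := by
      have := add_ne_zero_of_not_neg hβ (mul_pos hPr hpos)
      rwa [Complex.ofReal_mul] at this
    have hPr0 : (Pr : ℂ) ≠ 0 := by exact_mod_cast hPr.ne'
    have hP0 := hP 0
    have hP1 := hP 1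
    have hP2 := hP 2
    simp at hP0 hP1 hP2
    rw [Fin.sum_univ_three] at hdiv
    have hgsum : g = (freq L₁ L₂ n 0 : ℂ) ^ 2 + (freq L₁ L₂ n 1 : ℂ) ^ 2
        + (freq L₁ L₂ n 2 : ℂ) ^ 2 := by
      rw [hg, gammaSq_eq, Fin.sum_univ_three]; push_cast; rfl
    -- the pressure is eliminated by taking the divergence of the momentum equation
    have hgP : g * P + freq L₁ L₂ n 2 * (R * Θ - Real.sign Rt * Rt * Ψ) = 0 := by
      refine mul_left_cancel₀ hPr0 ?_
      linear_combination freq L₁ L₂ n 0 * hP0 + freq L₁ L₂ n 1 * hP1 + freq L₁ L₂ n 2 * hP2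
        + Pr * P * hgsum + (Pr * g + β) * hdiv
    have hvert : U 2 = 0 ∧ Θ = 0 ∧ Ψ = 0 := by
      by_cases hl : n 2 = 0
      · exact ⟨coeff_eq_zero (i := 2) (by simp [velType]) hl,
          coeff_eq_zero (i := 2) (by simp [velType]) hl,
          coeff_eq_zero (i := 2) (by simp [velType]) hl⟩
      · have hc : cubic Pr Le L₁ L₂ R Rt (n 0) (n 1) (n 2) β ≠ 0 := by
          by_cases hjk : n 0 ≠ 0 ∨ n 1 ≠ 0
          · exact hcub _ _ _ hjk hl
          · push Not at hjk
            have ha : alphaSq L₁ L₂ (n 0) (n 1) = 0 := by simp [alphaSq, hjk]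
            simp only [cubic, ha, ← hg]
            simp [hg0, hn1, hn2, hn3]
        have hs2 : (Real.sign Rt : ℂ) * Rt * Real.sign Rt = Rt := sign_mul_self_mul_sign Rt
        have ha : (alphaSq L₁ L₂ (n 0) (n 1) : ℂ) = g - (freq L₁ L₂ n 2 : ℂ) ^ 2 := by
          rw [alphaSq_eq, hgsum]; push_cast; ring
        -- elimination of `Θ`, `Ψ` and the pressure from the vertical momentum equation
        have hU2 : U 2 = 0 := by
          refine (mul_eq_zero.1 (?_ : cubic Pr Le L₁ L₂ R Rt (n 0) (n 1) (n 2) β * U 2 = 0)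
            ).resolve_left hc
          simp only [cubic, ← hg, ha]
          have hv : g * (Pr * g + β) * U 2
              = Pr * (g - (freq L₁ L₂ n 2 : ℂ) ^ 2) * (R * Θ - Real.sign Rt * Rt * Ψ) := by
            linear_combination -g * hP2 + Pr * freq L₁ L₂ n 2 * hgP
          linear_combination (g + β) * (Le * g + β) * hv
            + Pr * (g - (freq L₁ L₂ n 2 : ℂ) ^ 2) * R * (Le * g + β) * (-hT)
            + Pr * (g - (freq L₁ L₂ n 2 : ℂ) ^ 2) * (Real.sign Rt * Rt) * (g + β) * hS
            - Pr * (g - (freq L₁ L₂ n 2 : ℂ) ^ 2) * (g + β) * U 2 * hs2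
        rw [hU2] at hT hS
        exact ⟨hU2, (mul_eq_zero.1 (by linear_combination -hT : (g + β) * Θ = 0)).resolve_left hn1,
          (mul_eq_zero.1 (by linear_combination -hS : (Le * g + β) * Ψ = 0)).resolve_left hn2⟩
    obtain ⟨h2, h3, h4⟩ := hvert
    rw [h3, h4] at hgP
    have hP : P = 0 := (mul_eq_zero.1 (by linear_combination hgP : g * P = 0)).resolve_left hg0
    rw [hP] at hP0 hP1
    refine ⟨fun i => ?_, h3, h4⟩
    fin_cases i
    · exact (mul_eq_zero.1 (by linear_combination -hP0 : (Pr * g + β) * U 0 = 0)).resolve_left hn3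
    · exact (mul_eq_zero.1 (by linear_combination -hP1 : (Pr * g + β) * U 1 = 0)).resolve_left hn3
    · exact h2
  apply hne
  have hz := fun i => ae_eq_zero_of_integral_mode_eq_zero hL₁ hL₂
    (integrableOn_of_memLp (u i).memLp_val) (velType i) fun n => (key n).1 i
  have hT := ae_eq_zero_of_integral_mode_eq_zero hL₁ hL₂
    (integrableOn_of_memLp T.memLp_val) (velType 2) fun n => (key n).2.1
  have hS := ae_eq_zero_of_integral_mode_eq_zero hL₁ hL₂
    (integrableOn_of_memLp S.memLp_val) (velType 2) fun n => (key n).2.2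
  filter_upwards [ae_all_iff.2 hz, hT, hS] with x h1 h2 h3
  exact ⟨h1, h2, h3⟩

/-! ### The coefficients of the cubic and the Rayleigh numbers -/

/-- The coefficient of `β²` in the cubic divided by `γ²`; here `g` stands for `γ²`. -/
def quadCoeff (Pr Le g : ℝ) : ℝ := (1 + Le + Pr) * g

/-- The coefficient of `β` in the cubic divided by `γ²`; here `a` and `g` stand for `α²` and
`γ²`. -/
noncomputable def linCoeff (Pr Le R Rt a g : ℝ) : ℝ :=
  (Le + Pr + Le * Pr) * g ^ 2 - Pr * (R - Rt) * (a / g)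

/-- The constant coefficient of the cubic divided by `γ²`; here `a` and `g` stand for `α²` and
`γ²`. -/
def constCoeff (Pr Le R Rt a g : ℝ) : ℝ := Le * Pr * g ^ 3 - Pr * a * (Le * R - Rt)

theorem cubic_eq {Pr Le L₁ L₂ R Rt : ℝ} {j k l : ℕ} (hg : gammaSq L₁ L₂ j k l ≠ 0) (z : ℂ) :
    cubic Pr Le L₁ L₂ R Rt j k l z = (gammaSq L₁ L₂ j k l : ℂ) *
      (z ^ 3 + quadCoeff Pr Le (gammaSq L₁ L₂ j k l) * z ^ 2
        + linCoeff Pr Le R Rt (alphaSq L₁ L₂ j k) (gammaSq L₁ L₂ j k l) * z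
        + constCoeff Pr Le R Rt (alphaSq L₁ L₂ j k) (gammaSq L₁ L₂ j k l)) := by
  have : (gammaSq L₁ L₂ j k l : ℂ) ≠ 0 := by exact_mod_cast hg
  simp only [cubic, quadCoeff, linCoeff, constCoeff]
  push_cast
  field_simp
  ring

theorem isOrderedZeros_iff {Pr Le L₁ L₂ R Rt : ℝ} {j k l : ℕ} (hg : gammaSq L₁ L₂ j k l ≠ 0)
    {b : Fin 3 → ℂ} : IsOrderedZeros Pr Le L₁ L₂ R Rt j k l b ↔
      OrderedCubicZeros (quadCoeff Pr Le (gammaSq L₁ L₂ j k l))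
        (linCoeff Pr Le R Rt (alphaSq L₁ L₂ j k) (gammaSq L₁ L₂ j k l))
        (constCoeff Pr Le R Rt (alphaSq L₁ L₂ j k) (gammaSq L₁ L₂ j k l)) b := by
  have hg' : (gammaSq L₁ L₂ j k l : ℂ) ≠ 0 := by exact_mod_cast hg
  refine ⟨fun h => ⟨fun z => ?_, h.order₁, h.order₂⟩, fun h => ⟨fun z => ?_, h.order₁, h.order₂⟩⟩
  · exact mul_left_cancel₀ hg' ((cubic_eq hg z).symm.trans (h.factor z))
  · rw [cubic_eq hg, h.factor]

theorem constCoeff_eq {Pr Le : ℝ} (hLe : 0 < Le) (R Rt a g : ℝ) :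
    constCoeff Pr Le R Rt a g = Le * Pr * (g ^ 3 - a * rRayleigh Le R Rt) := by
  rw [constCoeff, rRayleigh]
  field_simp

/-- The Hurwitz determinant of the cubic. -/
theorem linCoeff_mul_quadCoeff_sub {Pr Le g : ℝ} (hPr : 0 < Pr) (hg : g ≠ 0) (R Rt a : ℝ) :
    linCoeff Pr Le R Rt a g * quadCoeff Pr Le g - constCoeff Pr Le R Rt a g
      = (1 + Pr) * Pr * ((Pr + Le) * (1 + Le) / Pr * g ^ 3 - a * cRayleigh Pr Le R Rt) := by
  rw [linCoeff, quadCoeff, constCoeff, cRayleigh]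
  have : Pr + 1 ≠ 0 := by positivity
  field_simp
  ring

theorem modeRayleigh_mul_alphaSq {L₁ L₂ : ℝ} (hL₁ : 0 < L₁) (hL₂ : 0 < L₂) {j k : ℕ}
    (hjk : j ≠ 0 ∨ k ≠ 0) :
    modeRayleigh L₁ L₂ j k * alphaSq L₁ L₂ j k = gammaSq L₁ L₂ j k 1 ^ 3 := by
  have h := alphaSq_pos hL₁ hL₂ hjk
  rw [alphaSq] at h
  have h' := (pos_of_mul_pos_right h (by positivity)).ne'
  rw [modeRayleigh, gammaSq, alphaSq]
  generalize (j : ℝ) ^ 2 * (L₁ ^ 2)⁻¹ + (k : ℝ) ^ 2 * (L₂ ^ 2)⁻¹ = A at h' ⊢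
  field_simp
  push_cast
  ring

theorem sigmaC_le {L₁ L₂ : ℝ} {j k : ℕ} (hjk : j ≠ 0 ∨ k ≠ 0) :
    sigmaC L₁ L₂ ≤ modeRayleigh L₁ L₂ j k := by
  refine csInf_le ⟨0, ?_⟩ ⟨j, k, hjk, rfl⟩
  rintro s ⟨j, k, -, rfl⟩
  rw [modeRayleigh]
  positivity

theorem gammaSq_one_lt {L₁ L₂ : ℝ} {j k l : ℕ} (hl : l ≠ 0) (hl1 : l ≠ 1) :
    gammaSq L₁ L₂ j k 1 < gammaSq L₁ L₂ j k l := by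
  have : (1 : ℝ) < l := by exact_mod_cast (by omega : 1 < l)
  have hpi := Real.pi_pos
  rw [gammaSq, gammaSq]
  gcongr
  simpa using this

section Critical

variable {L₁ L₂ : ℝ} {j k l : ℕ}

theorem IsCriticalMode.gammaSq_pow (h : IsCriticalMode L₁ L₂ j k) (hL₁ : 0 < L₁) (hL₂ : 0 < L₂) :
    gammaSq L₁ L₂ j k 1 ^ 3 = alphaSq L₁ L₂ j k * sigmaC L₁ L₂ := by
  rw [← modeRayleigh_mul_alphaSq hL₁ hL₂ h.1, h.2, mul_comm]

theorem alphaSq_mul_sigmaC_lt (hL₁ : 0 < L₁) (hL₂ : 0 < L₂) (hjk : j ≠ 0 ∨ k ≠ 0) (hl : l ≠ 0)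
    (hn : ¬(IsCriticalMode L₁ L₂ j k ∧ l = 1)) :
    alphaSq L₁ L₂ j k * sigmaC L₁ L₂ < gammaSq L₁ L₂ j k l ^ 3 := by
  have ha := alphaSq_pos hL₁ hL₂ hjk
  have hg := gammaSq_pos hL₁ hL₂ (l := 1) (hjk.imp_right Or.inl)
  have h1 : alphaSq L₁ L₂ j k * sigmaC L₁ L₂ ≤ gammaSq L₁ L₂ j k 1 ^ 3 := by
    rw [← modeRayleigh_mul_alphaSq hL₁ hL₂ hjk, mul_comm]
    exact mul_le_mul_of_nonneg_right (sigmaC_le hjk) ha.le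
  by_cases hl1 : l = 1
  · subst hl1
    have : sigmaC L₁ L₂ < modeRayleigh L₁ L₂ j k :=
      lt_of_le_of_ne (sigmaC_le hjk) fun h => hn ⟨⟨hjk, h.symm⟩, rfl⟩
    rw [← modeRayleigh_mul_alphaSq hL₁ hL₂ hjk, mul_comm]
    exact mul_lt_mul_of_pos_right this ha
  · exact h1.trans_lt (pow_lt_pow_left₀ (gammaSq_one_lt hl hl1) hg.le (by norm_num))

end Critical

/-- The sign of `K` decides which of `σ` and `η` reaches its critical value first when `R`
increases. -/
theorem exists_etaC_sub_cRayleigh {Pr Le : ℝ} (hPr : 0 < Pr) (hLe : 0 < Le) (hLe1 : Le ≠ 1)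
    (L₁ L₂ Rt : ℝ) : ∃ κ > 0, ∀ R, etaC Pr Le L₁ L₂ - cRayleigh Pr Le R Rt
      = sigmaC L₁ L₂ - rRayleigh Le R Rt + κ * K Pr Le L₁ L₂ Rt := by
  have h1 : (1 - Le) ≠ 0 := sub_ne_zero.2 hLe1.symm
  refine ⟨(Pr + 1 + Le) * |1 - Le| / (Le * (Pr + 1)), by positivity, fun R => ?_⟩
  have hs : |1 - Le| * Real.sign (1 - Le) = 1 - Le := by
    rcases lt_or_gt_of_ne h1 with h | h
    · rw [Real.sign_of_neg h, abs_of_neg h]; ring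
    · rw [Real.sign_of_pos h, abs_of_pos h]; ring
  have e : (Pr + 1 + Le) * |1 - Le| / (Le * (Pr + 1)) * K Pr Le L₁ L₂ Rt
      = (Pr + 1 + Le) * (1 - Le) / (Le * (Pr + 1))
        * (Le ^ 2 / (1 - Le) * (1 + 1 / Pr) * sigmaC L₁ L₂ - Rt) := by
    rw [K]
    linear_combination (Pr + 1 + Le) / (Le * (Pr + 1))
        * (Le ^ 2 / (1 - Le) * (1 + 1 / Pr) * sigmaC L₁ L₂ - Rt) * hs
  rw [e, etaC, cRayleigh, rRayleigh]
  have : Pr + 1 ≠ 0 := by positivity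
  field_simp
  ring

/-! ### Stability of the modes -/

/-- In terms of the Rayleigh numbers, the Routh–Hurwitz conditions for a mode are `α² σ < γ⁶` and
`α² η < (Pr + Le) (1 + Le) / Pr · γ⁶`. -/
theorem re_neg_of_cubic_eq_zero {Pr Le L₁ L₂ R Rt : ℝ} (hPr : 0 < Pr) (hLe : 0 < Le)
    {j k l : ℕ} (hg : 0 < gammaSq L₁ L₂ j k l)
    (hσ : alphaSq L₁ L₂ j k * rRayleigh Le R Rt < gammaSq L₁ L₂ j k l ^ 3)
    (hη : alphaSq L₁ L₂ j k * cRayleigh Pr Le R Rt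
      < (Pr + Le) * (1 + Le) / Pr * gammaSq L₁ L₂ j k l ^ 3)
    {β : ℂ} (hβ : cubic Pr Le L₁ L₂ R Rt j k l β = 0) : β.re < 0 := by
  have hg' : (gammaSq L₁ L₂ j k l : ℂ) ≠ 0 := by exact_mod_cast hg.ne'
  rw [cubic_eq hg.ne'] at hβ
  refine re_neg_of_cubic_zero ?_ ?_ ?_ ((mul_eq_zero.1 hβ).resolve_left hg')
  · rw [quadCoeff]; positivity
  · rw [constCoeff_eq hLe]
    have := sub_pos.2 hσ
    positivity
  · rw [← sub_pos, linCoeff_mul_quadCoeff_sub hPr hg.ne']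
    have := sub_pos.2 hη
    positivity

/-- If neither Rayleigh number exceeds its critical value, every mode except the critical ones is
stable. -/
theorem re_neg_of_not_critical {Pr Le L₁ L₂ R Rt : ℝ} (hPr : 0 < Pr) (hLe : 0 < Le)
    (hL₁ : 0 < L₁) (hL₂ : 0 < L₂) (hσ : rRayleigh Le R Rt ≤ sigmaC L₁ L₂)
    (hη : cRayleigh Pr Le R Rt ≤ etaC Pr Le L₁ L₂) {j k l : ℕ} (hjk : j ≠ 0 ∨ k ≠ 0) (hl : l ≠ 0)
    (hn : ¬(IsCriticalMode L₁ L₂ j k ∧ l = 1)) {β : ℂ}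
    (hβ : cubic Pr Le L₁ L₂ R Rt j k l β = 0) : β.re < 0 := by
  have ha := alphaSq_pos hL₁ hL₂ hjk
  have hlt := alphaSq_mul_sigmaC_lt hL₁ hL₂ hjk hl hn
  refine re_neg_of_cubic_eq_zero hPr hLe (gammaSq_pos hL₁ hL₂ (hjk.imp_right Or.inl)) ?_ ?_ hβ
  · exact (mul_le_mul_of_nonneg_left hσ ha.le).trans_lt hlt
  · calc _ ≤ alphaSq L₁ L₂ j k * etaC Pr Le L₁ L₂ := mul_le_mul_of_nonneg_left hη ha.le
      _ = (Pr + Le) * (1 + Le) / Pr * (alphaSq L₁ L₂ j k * sigmaC L₁ L₂) := by rw [etaC]; ring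
      _ < _ := mul_lt_mul_of_pos_left hlt (by positivity)

theorem modeEigenvalue_re_neg {Pr Le L₁ L₂ R Rt : ℝ} (hPr : 0 < Pr) (hLe : 0 < Le)
    (hL₁ : 0 < L₁) (hL₂ : 0 < L₂) (hσ : rRayleigh Le R Rt ≤ sigmaC L₁ L₂)
    (hη : cRayleigh Pr Le R Rt ≤ etaC Pr Le L₁ L₂) {j k l : ℕ}
    (hn : ¬(IsCriticalMode L₁ L₂ j k ∧ l = 1)) {β : ℂ}
    (hβ : IsModeEigenvalue Pr Le L₁ L₂ R Rt j k l β) : β.re < 0 := by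
  have hpi := Real.pi_pos
  rcases hβ with ⟨hjk, -, rfl⟩ | ⟨-, -, hl, rfl | rfl⟩ | ⟨hjk, hl, hβ⟩
  · have := alphaSq_pos hL₁ hL₂ hjk
    rw [Complex.ofReal_re, neg_lt_zero]
    positivity
  · rw [Complex.ofReal_re, neg_lt_zero]
    positivity
  · rw [Complex.ofReal_re, neg_lt_zero]
    positivity
  · exact re_neg_of_not_critical hPr hLe hL₁ hL₂ hσ hη hjk hl hn hβ

/-- If neither Rayleigh number exceeds its critical value, the only eigenvalues that may fail to
have a negative real part come from the critical modes. -/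
theorem re_neg_or_critical_of_isEigenvalue {Pr Le L₁ L₂ R Rt : ℝ} (hPr : 0 < Pr) (hLe : 0 < Le)
    (hL₁ : 0 < L₁) (hL₂ : 0 < L₂) (hσ : rRayleigh Le R Rt ≤ sigmaC L₁ L₂)
    (hη : cRayleigh Pr Le R Rt ≤ etaC Pr Le L₁ L₂) {β : ℂ}
    (hE : IsEigenvalue Pr Le L₁ L₂ R Rt β) : β.re < 0 ∨
      ∃ j k, IsCriticalMode L₁ L₂ j k ∧ cubic Pr Le L₁ L₂ R Rt j k 1 β = 0 := by
  by_cases hβ : β.im = 0 ∧ β.re < 0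
  · exact Or.inl hβ.2
  obtain ⟨j, k, l, hjk, hl, hc⟩ := exists_cubic_eq_zero_of_isEigenvalue hPr hLe hL₁ hL₂ hE hβ
  by_cases hn : IsCriticalMode L₁ L₂ j k ∧ l = 1
  · obtain ⟨hcr, rfl⟩ := hn
    exact Or.inr ⟨j, k, hcr, hc⟩
  · exact Or.inl (re_neg_of_not_critical hPr hLe hL₁ hL₂ hσ hη hjk hl hn hc)

section CriticalMode

variable {Pr Le L₁ L₂ R Rt : ℝ} {j k : ℕ}

theorem IsCriticalMode.gammaSq_pos (h : IsCriticalMode L₁ L₂ j k) (hL₁ : 0 < L₁) (hL₂ : 0 < L₂) :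
    0 < gammaSq L₁ L₂ j k 1 :=
  Thermohaline.gammaSq_pos hL₁ hL₂ (h.1.imp_right Or.inl)

theorem IsCriticalMode.constCoeff_eq (h : IsCriticalMode L₁ L₂ j k) (hLe : 0 < Le) (hL₁ : 0 < L₁)
    (hL₂ : 0 < L₂) : constCoeff Pr Le R Rt (alphaSq L₁ L₂ j k) (gammaSq L₁ L₂ j k 1)
      = Le * Pr * alphaSq L₁ L₂ j k * (sigmaC L₁ L₂ - rRayleigh Le R Rt) := by
  rw [Thermohaline.constCoeff_eq hLe, h.gammaSq_pow hL₁ hL₂]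
  ring

theorem IsCriticalMode.hurwitz_eq (h : IsCriticalMode L₁ L₂ j k) (hPr : 0 < Pr) (hL₁ : 0 < L₁)
    (hL₂ : 0 < L₂) : linCoeff Pr Le R Rt (alphaSq L₁ L₂ j k) (gammaSq L₁ L₂ j k 1)
        * quadCoeff Pr Le (gammaSq L₁ L₂ j k 1)
        - constCoeff Pr Le R Rt (alphaSq L₁ L₂ j k) (gammaSq L₁ L₂ j k 1)
      = (1 + Pr) * Pr * alphaSq L₁ L₂ j k * (etaC Pr Le L₁ L₂ - cRayleigh Pr Le R Rt) := by
  rw [linCoeff_mul_quadCoeff_sub hPr (h.gammaSq_pos hL₁ hL₂).ne', h.gammaSq_pow hL₁ hL₂, etaC]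
  ring

theorem IsCriticalMode.quadCoeff_pos (h : IsCriticalMode L₁ L₂ j k) (hPr : 0 < Pr) (hLe : 0 < Le)
    (hL₁ : 0 < L₁) (hL₂ : 0 < L₂) : 0 < quadCoeff Pr Le (gammaSq L₁ L₂ j k 1) := by
  have := h.gammaSq_pos hL₁ hL₂
  rw [quadCoeff]
  positivity

/-- At `σ = σ_c` and `η < η_c`, the cubic of a critical mode is `β` times a stable quadratic. -/
theorem IsCriticalMode.coeffs_at_sigmaC (h : IsCriticalMode L₁ L₂ j k) (hPr : 0 < Pr)
    (hLe : 0 < Le) (hL₁ : 0 < L₁) (hL₂ : 0 < L₂) (hσ : rRayleigh Le R Rt = sigmaC L₁ L₂)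
    (hη : cRayleigh Pr Le R Rt < etaC Pr Le L₁ L₂) :
    constCoeff Pr Le R Rt (alphaSq L₁ L₂ j k) (gammaSq L₁ L₂ j k 1) = 0 ∧
      0 < linCoeff Pr Le R Rt (alphaSq L₁ L₂ j k) (gammaSq L₁ L₂ j k 1) := by
  have h0 : constCoeff Pr Le R Rt (alphaSq L₁ L₂ j k) (gammaSq L₁ L₂ j k 1) = 0 := by
    rw [h.constCoeff_eq hLe hL₁ hL₂, hσ, sub_self, mul_zero]
  refine ⟨h0, ?_⟩
  have hH := h.hurwitz_eq (Le := Le) (R := R) (Rt := Rt) hPr hL₁ hL₂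
  rw [h0, sub_zero] at hH
  have ha := alphaSq_pos hL₁ hL₂ h.1
  have hη' := sub_pos.2 hη
  exact pos_of_mul_pos_left (hH ▸ by positivity) (h.quadCoeff_pos hPr hLe hL₁ hL₂).le

/-- At `η = η_c` and `σ < σ_c`, the Hurwitz determinant of a critical mode vanishes. -/
theorem IsCriticalMode.coeffs_at_etaC (h : IsCriticalMode L₁ L₂ j k) (hPr : 0 < Pr)
    (hLe : 0 < Le) (hL₁ : 0 < L₁) (hL₂ : 0 < L₂) (hσ : rRayleigh Le R Rt < sigmaC L₁ L₂)
    (hη : cRayleigh Pr Le R Rt = etaC Pr Le L₁ L₂) :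
    constCoeff Pr Le R Rt (alphaSq L₁ L₂ j k) (gammaSq L₁ L₂ j k 1)
        = linCoeff Pr Le R Rt (alphaSq L₁ L₂ j k) (gammaSq L₁ L₂ j k 1)
          * quadCoeff Pr Le (gammaSq L₁ L₂ j k 1) ∧
      0 < linCoeff Pr Le R Rt (alphaSq L₁ L₂ j k) (gammaSq L₁ L₂ j k 1) := by
  have hH := h.hurwitz_eq (Le := Le) (R := R) (Rt := Rt) hPr hL₁ hL₂
  rw [hη, sub_self, mul_zero, sub_eq_zero] at hH
  refine ⟨hH.symm, ?_⟩
  have ha := alphaSq_pos hL₁ hL₂ h.1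
  have h0 := h.constCoeff_eq (Pr := Pr) (R := R) (Rt := Rt) hLe hL₁ hL₂
  have hσ' := sub_pos.2 hσ
  refine pos_of_mul_pos_left ?_ (h.quadCoeff_pos hPr hLe hL₁ hL₂).le
  rw [hH, h0]
  positivity

theorem IsCriticalMode.re_neg (h : IsCriticalMode L₁ L₂ j k) (hPr : 0 < Pr) (hLe : 0 < Le)
    (hL₁ : 0 < L₁) (hL₂ : 0 < L₂) (hσ : rRayleigh Le R Rt < sigmaC L₁ L₂)
    (hη : cRayleigh Pr Le R Rt < etaC Pr Le L₁ L₂) {β : ℂ}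
    (hβ : cubic Pr Le L₁ L₂ R Rt j k 1 β = 0) : β.re < 0 := by
  have ha := alphaSq_pos hL₁ hL₂ h.1
  refine re_neg_of_cubic_eq_zero hPr hLe (h.gammaSq_pos hL₁ hL₂) ?_ ?_ hβ
  · rw [h.gammaSq_pow hL₁ hL₂]
    exact mul_lt_mul_of_pos_left hσ ha
  · calc _ < alphaSq L₁ L₂ j k * etaC Pr Le L₁ L₂ := mul_lt_mul_of_pos_left hη ha
      _ = _ := by rw [h.gammaSq_pow hL₁ hL₂, etaC]; ring

end CriticalMode

theorem cubic_isOrderedZeros {Pr Le L₁ L₂ R Rt : ℝ} {j k l : ℕ} {b : Fin 3 → ℂ}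
    (hb : IsOrderedZeros Pr Le L₁ L₂ R Rt j k l b) (i : Fin 3) :
    cubic Pr Le L₁ L₂ R Rt j k l (b i) = 0 := by
  rw [hb.factor]
  fin_cases i <;> simp

theorem exists_near_of_continuous {F : ℝ → ℝ} (hF : Continuous F) {R₀ : ℝ} (h : F R₀ < 0) :
    ∃ ε > 0, ∀ R, |R - R₀| < ε → F R < 0 :=
  Metric.eventually_nhds_iff.1 (hF.continuousAt.eventually (gt_mem_nhds h))

theorem continuous_linCoeff (Pr Le Rt a g : ℝ) : Continuous fun R => linCoeff Pr Le R Rt a g := by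
  unfold linCoeff; fun_prop

theorem continuous_constCoeff (Pr Le Rt a g : ℝ) :
    Continuous fun R => constCoeff Pr Le R Rt a g := by
  unfold constCoeff; fun_prop

end Thermohaline

open Thermohaline
theorem theorem3p1 (Pr Le L₁ L₂ Rt : ℝ) (hPr : 0 < Pr) (hLe : 0 < Le) (hL₁ : 0 < L₁)
    (hL₂ : 0 < L₂) (hLe1 : Le ≠ 1) (j₁ k₁ : ℕ) (hcrit : IsCriticalMode L₁ L₂ j₁ k₁) :
    (0 < K Pr Le L₁ L₂ Rt →
      SigmaCIsFirstCritical Pr Le L₁ L₂ Rt ∧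
      -- behaviour of the first eigenvalue of the critical mode
      (∀ (R : ℝ) (b : Fin 3 → ℂ), IsOrderedZeros Pr Le L₁ L₂ R Rt j₁ k₁ 1 b →
        IsEigenvalue Pr Le L₁ L₂ R Rt (b 0) ∧
        (rRayleigh Le R Rt < sigmaC L₁ L₂ → (b 0).re < 0) ∧
        (rRayleigh Le R Rt = sigmaC L₁ L₂ → b 0 = 0 ∧ (b 1).re < 0 ∧ (b 2).re < 0) ∧
        (sigmaC L₁ L₂ < rRayleigh Le R Rt → (b 0).im = 0 ∧ 0 < (b 0).re)) ∧
      -- this eigenvalue is real near the critical value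
      (∃ ε : ℝ, 0 < ε ∧ ∀ (R : ℝ) (b : Fin 3 → ℂ), |rRayleigh Le R Rt - sigmaC L₁ L₂| < ε →
        IsOrderedZeros Pr Le L₁ L₂ R Rt j₁ k₁ 1 b → (b 0).im = 0) ∧
      -- all other eigenvalues at the critical value
      (∀ R : ℝ, rRayleigh Le R Rt = sigmaC L₁ L₂ →
        (∀ j k l : ℕ, ¬ (IsCriticalMode L₁ L₂ j k ∧ l = 1) →
          ∀ β : ℂ, IsModeEigenvalue Pr Le L₁ L₂ R Rt j k l β → β.re < 0) ∧
        (∀ β : ℂ, IsEigenvalue Pr Le L₁ L₂ R Rt β → β ≠ 0 → β.re < 0))) ∧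
    (K Pr Le L₁ L₂ Rt < 0 →
      EtaCIsFirstCritical Pr Le L₁ L₂ Rt ∧
      -- behaviour of the first two eigenvalues of the critical mode
      (∀ (R : ℝ) (b : Fin 3 → ℂ), IsOrderedZeros Pr Le L₁ L₂ R Rt j₁ k₁ 1 b →
        IsEigenvalue Pr Le L₁ L₂ R Rt (b 0) ∧ IsEigenvalue Pr Le L₁ L₂ R Rt (b 1) ∧
        (cRayleigh Pr Le R Rt < etaC Pr Le L₁ L₂ → (b 0).re < 0 ∧ (b 1).re < 0) ∧
        (cRayleigh Pr Le R Rt = etaC Pr Le L₁ L₂ →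
          (b 0).re = 0 ∧ (b 1).re = 0 ∧ (b 2).re < 0) ∧
        (etaC Pr Le L₁ L₂ < cRayleigh Pr Le R Rt → 0 < (b 0).re)) ∧
      -- near the critical value they form a pair of nonreal complex conjugates
      (∃ ε : ℝ, 0 < ε ∧ ∀ (R : ℝ) (b : Fin 3 → ℂ),
        |cRayleigh Pr Le R Rt - etaC Pr Le L₁ L₂| < ε →
        IsOrderedZeros Pr Le L₁ L₂ R Rt j₁ k₁ 1 b →
        (b 0).im ≠ 0 ∧ b 1 = star (b 0) ∧ (b 0).re = (b 1).re ∧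
        (etaC Pr Le L₁ L₂ < cRayleigh Pr Le R Rt → 0 < (b 1).re)) ∧
      -- all other eigenvalues at the critical value
      (∀ R : ℝ, cRayleigh Pr Le R Rt = etaC Pr Le L₁ L₂ →
        (∀ j k l : ℕ, ¬ (IsCriticalMode L₁ L₂ j k ∧ l = 1) →
          ∀ β : ℂ, IsModeEigenvalue Pr Le L₁ L₂ R Rt j k l β → β.re < 0) ∧
        (∀ β : ℂ, IsEigenvalue Pr Le L₁ L₂ R Rt β →
          (∀ (j k : ℕ) (b : Fin 3 → ℂ), IsCriticalMode L₁ L₂ j k →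
            IsOrderedZeros Pr Le L₁ L₂ R Rt j k 1 b → β ≠ b 0 ∧ β ≠ b 1) → β.re < 0))) := by
  obtain ⟨κ, hκ, hκK⟩ := exists_etaC_sub_cRayleigh hPr hLe hLe1 L₁ L₂ Rt
  have hg₁ := hcrit.gammaSq_pos hL₁ hL₂
  have ha₁ := alphaSq_pos hL₁ hL₂ hcrit.1
  have hq₁ := hcrit.quadCoeff_pos hPr hLe hL₁ hL₂
  constructor
  · intro hK
    have hκK' := mul_pos hκ hK
    have hη : ∀ R, rRayleigh Le R Rt ≤ sigmaC L₁ L₂ →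
        cRayleigh Pr Le R Rt < etaC Pr Le L₁ L₂ := fun R hR => by
      have := hκK R
      linarith
    have hspec : ∀ R, rRayleigh Le R Rt = sigmaC L₁ L₂ → ∀ β,
        IsEigenvalue Pr Le L₁ L₂ R Rt β → β ≠ 0 → β.re < 0 := by
      intro R hR β hE h0
      rcases re_neg_or_critical_of_isEigenvalue hPr hLe hL₁ hL₂ hR.le (hη R hR.le).le hE with
        h | ⟨j, k, hjk, hc⟩
      · exact h
      · obtain ⟨h₀, h₁⟩ := hjk.coeffs_at_sigmaC hPr hLe hL₁ hL₂ hR (hη R hR.le)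
        have hg := hjk.gammaSq_pos hL₁ hL₂
        have hg' : (gammaSq L₁ L₂ j k 1 : ℂ) ≠ 0 := by exact_mod_cast hg.ne'
        rw [cubic_eq hg.ne', h₀, Complex.ofReal_zero, add_zero] at hc
        exact (eq_zero_or_re_neg_of_cubic_zero (hjk.quadCoeff_pos hPr hLe hL₁ hL₂) h₁
          ((mul_eq_zero.1 hc).resolve_left hg')).resolve_left h0
    refine ⟨fun R hR β hE => ?_, fun R b hb => ⟨?_, fun hR => ?_, fun hR => ?_, fun hR => ?_⟩, ?_,
      fun R hR => ⟨fun j k l hn β hβ => ?_, hspec R hR⟩⟩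
    · rcases eq_or_ne β 0 with rfl | h0
      · simp
      · exact (hspec R hR β hE h0).le
    · exact isEigenvalue_of_cubic hPr hL₁ hL₂ hcrit.1 (cubic_isOrderedZeros hb 0)
    · exact hcrit.re_neg hPr hLe hL₁ hL₂ hR (hη R hR.le) (cubic_isOrderedZeros hb 0)
    · obtain ⟨h₀, h₁⟩ := hcrit.coeffs_at_sigmaC hPr hLe hL₁ hL₂ hR (hη R hR.le)
      have hb' := (isOrderedZeros_iff hg₁.ne').1 hb
      rw [h₀] at hb'
      exact hb'.eq_zero_of_const_eq_zero hq₁ h₁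
    · refine ((isOrderedZeros_iff hg₁.ne').1 hb).real_pos_of_const_neg hq₁ ?_
      rw [hcrit.constCoeff_eq hLe hL₁ hL₂]
      exact mul_neg_of_pos_of_neg (by positivity) (by linarith)
    · set R₀ : ℝ := sigmaC L₁ L₂ + Le⁻¹ * Rt with hR₀
      have hσ₀ : rRayleigh Le R₀ Rt = sigmaC L₁ L₂ := by rw [rRayleigh, hR₀]; ring
      obtain ⟨h₀, h₁⟩ := hcrit.coeffs_at_sigmaC hPr hLe hL₁ hL₂ hσ₀ (hη R₀ hσ₀.le)
      set q := quadCoeff Pr Le (gammaSq L₁ L₂ j₁ k₁ 1)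
      set m := linCoeff Pr Le R₀ Rt (alphaSq L₁ L₂ j₁ k₁) (gammaSq L₁ L₂ j₁ k₁ 1)
      -- at `R₀` the cubic is negative at `-δ`
      obtain ⟨δ, hδ, hδq, hδm⟩ : ∃ δ > 0, 3 * δ ≤ q ∧ q * δ < m := by
        refine ⟨min (q / 3) (m / (2 * q)), by positivity, ?_, ?_⟩
        · linarith [min_le_left (q / 3) (m / (2 * q))]
        · calc q * min (q / 3) (m / (2 * q)) ≤ q * (m / (2 * q)) := by gcongr; exact min_le_right _ _
            _ = m / 2 := by field_simp
            _ < m := by linarith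
      obtain ⟨ε, hε, hF⟩ := exists_near_of_continuous
        (F := fun R => (-δ) ^ 3 + q * (-δ) ^ 2
          + linCoeff Pr Le R Rt (alphaSq L₁ L₂ j₁ k₁) (gammaSq L₁ L₂ j₁ k₁ 1) * (-δ)
          + constCoeff Pr Le R Rt (alphaSq L₁ L₂ j₁ k₁) (gammaSq L₁ L₂ j₁ k₁ 1)) (R₀ := R₀)
        (by
          have := continuous_linCoeff Pr Le Rt (alphaSq L₁ L₂ j₁ k₁) (gammaSq L₁ L₂ j₁ k₁ 1)
          have := continuous_constCoeff Pr Le Rt (alphaSq L₁ L₂ j₁ k₁) (gammaSq L₁ L₂ j₁ k₁ 1)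
          fun_prop)
        (by
          rw [h₀]
          have : 0 < δ * (δ ^ 2 + (m - q * δ)) := by
            have := sub_pos.2 hδm
            positivity
          linarith)
      refine ⟨ε, hε, fun R b hR hb => ?_⟩
      refine ((isOrderedZeros_iff hg₁.ne').1 hb).im_eq_zero_of_neg hδq (hF R ?_)
      rwa [show R - R₀ = rRayleigh Le R Rt - sigmaC L₁ L₂ by rw [rRayleigh, hR₀]; ring]
    · exact modeEigenvalue_re_neg hPr hLe hL₁ hL₂ hR.le (hη R hR.le).le hn hβ
  · intro hK
    have hκK' := mul_neg_of_pos_of_neg hκ hK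
    have hσ : ∀ R, cRayleigh Pr Le R Rt ≤ etaC Pr Le L₁ L₂ →
        rRayleigh Le R Rt < sigmaC L₁ L₂ := fun R hR => by
      have := hκK R
      linarith
    have hpos : ∀ (R : ℝ) (b : Fin 3 → ℂ), IsOrderedZeros Pr Le L₁ L₂ R Rt j₁ k₁ 1 b →
        etaC Pr Le L₁ L₂ < cRayleigh Pr Le R Rt → 0 < (b 0).re := by
      intro R b hb hR
      refine ((isOrderedZeros_iff hg₁.ne').1 hb).re_pos_of_lt ?_
      rw [← sub_neg, hcrit.hurwitz_eq hPr hL₁ hL₂]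
      exact mul_neg_of_pos_of_neg (by positivity) (by linarith)
    -- at `η_c` an eigenvalue with nonnegative real part is one of the first two zeros
    have hspec : ∀ R, cRayleigh Pr Le R Rt = etaC Pr Le L₁ L₂ → ∀ β,
        IsEigenvalue Pr Le L₁ L₂ R Rt β → β.re < 0 ∨ ∃ j k b, IsCriticalMode L₁ L₂ j k ∧
          IsOrderedZeros Pr Le L₁ L₂ R Rt j k 1 b ∧ (b 0).re = 0 ∧ (b 1).re = 0 ∧
          (β = b 0 ∨ β = b 1) := by
      intro R hR β hE
      rcases re_neg_or_critical_of_isEigenvalue hPr hLe hL₁ hL₂ (hσ R hR.le).le hR.le hE with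
        h | ⟨j, k, hjk, hc⟩
      · exact Or.inl h
      · obtain ⟨h₀, h₁⟩ := hjk.coeffs_at_etaC hPr hLe hL₁ hL₂ (hσ R hR.le) hR
        have hg := hjk.gammaSq_pos hL₁ hL₂
        have hg' : (gammaSq L₁ L₂ j k 1 : ℂ) ≠ 0 := by exact_mod_cast hg.ne'
        have hq := hjk.quadCoeff_pos hPr hLe hL₁ hL₂
        obtain ⟨b, hb⟩ := exists_orderedCubicZeros hq h₁ h₀
        obtain ⟨r0, r1, r2⟩ := hb.re_of_eq hq h₁ h₀
        rw [cubic_eq hg.ne'] at hc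
        rcases hb.eq_of_zero ((mul_eq_zero.1 hc).resolve_left hg') with e | e | e
        · exact Or.inr ⟨j, k, b, hjk, (isOrderedZeros_iff hg.ne').2 hb, r0, r1, Or.inl e⟩
        · exact Or.inr ⟨j, k, b, hjk, (isOrderedZeros_iff hg.ne').2 hb, r0, r1, Or.inr e⟩
        · exact Or.inl (e ▸ r2)
    refine ⟨fun R hR β hE => ?_, fun R b hb => ⟨?_, ?_, fun hR => ⟨?_, ?_⟩, fun hR => ?_,
      hpos R b hb⟩, ?_, fun R hR => ⟨fun j k l hn β hβ => ?_, fun β hE hne => ?_⟩⟩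
    · rcases hspec R hR β hE with h | ⟨j, k, b, -, -, r0, r1, rfl | rfl⟩
      · exact h.le
      · exact r0.le
      · exact r1.le
    · exact isEigenvalue_of_cubic hPr hL₁ hL₂ hcrit.1 (cubic_isOrderedZeros hb 0)
    · exact isEigenvalue_of_cubic hPr hL₁ hL₂ hcrit.1 (cubic_isOrderedZeros hb 1)
    · exact hcrit.re_neg hPr hLe hL₁ hL₂ (hσ R hR.le) hR (cubic_isOrderedZeros hb 0)
    · exact hcrit.re_neg hPr hLe hL₁ hL₂ (hσ R hR.le) hR (cubic_isOrderedZeros hb 1)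
    · obtain ⟨h₀, h₁⟩ := hcrit.coeffs_at_etaC hPr hLe hL₁ hL₂ (hσ R hR.le) hR
      exact ((isOrderedZeros_iff hg₁.ne').1 hb).re_of_eq hq₁ h₁ h₀
    · set R₀ : ℝ := etaC Pr Le L₁ L₂ + (Pr + Le) / (Pr + 1) * Rt with hR₀
      have hη₀ : cRayleigh Pr Le R₀ Rt = etaC Pr Le L₁ L₂ := by rw [cRayleigh, hR₀]; ring
      obtain ⟨h₀, h₁⟩ := hcrit.coeffs_at_etaC hPr hLe hL₁ hL₂ (hσ R₀ hη₀.le) hη₀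
      set q := quadCoeff Pr Le (gammaSq L₁ L₂ j₁ k₁ 1)
      obtain ⟨ε, hε, hF⟩ := exists_near_of_continuous
        (F := fun R => |constCoeff Pr Le R Rt (alphaSq L₁ L₂ j₁ k₁) (gammaSq L₁ L₂ j₁ k₁ 1)
            - linCoeff Pr Le R Rt (alphaSq L₁ L₂ j₁ k₁) (gammaSq L₁ L₂ j₁ k₁ 1) * q|
          - linCoeff Pr Le R Rt (alphaSq L₁ L₂ j₁ k₁) (gammaSq L₁ L₂ j₁ k₁ 1) * q / 3) (R₀ := R₀)
        (by
          have := continuous_linCoeff Pr Le Rt (alphaSq L₁ L₂ j₁ k₁) (gammaSq L₁ L₂ j₁ k₁ 1)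
          have := continuous_constCoeff Pr Le Rt (alphaSq L₁ L₂ j₁ k₁) (gammaSq L₁ L₂ j₁ k₁ 1)
          fun_prop)
        (by
          rw [h₀, sub_self, abs_zero, zero_sub, neg_lt_zero]
          positivity)
      refine ⟨ε, hε, fun R b hR hb => ?_⟩
      have hFR := hF R (by
        rwa [show R - R₀ = cRayleigh Pr Le R Rt - etaC Pr Le L₁ L₂ by rw [cRayleigh, hR₀]; ring])
      obtain ⟨i0, e, -⟩ := ((isOrderedZeros_iff hg₁.ne').1 hb).conj_of_near hq₁ (sub_neg.1 hFR)
      have hre : (b 0).re = (b 1).re := by rw [e]; simp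
      exact ⟨i0, e, hre, fun h => hre ▸ hpos R b hb h⟩
    · exact modeEigenvalue_re_neg hPr hLe hL₁ hL₂ (hσ R hR.le).le hR.le hn hβ
    · rcases hspec R hR β hE with h | ⟨j, k, b, hjk, hb, -, -, h | h⟩
      · exact h
      · exact absurd h (hne j k b hjk hb).1
      · exact absurd h (hne j k b hjk hb).2
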